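/- Let $p$ be a prime and let $dx$ be the Haar measure on $\mathbb{Q}_p$ with $\int_{|x|_p\le 1}dx=1$. Write $B_0(0)=\{x\in\mathbb{Q}_p:|x|_p\le 1\}$, and let $$I_p=\{p^{-\gamma}(a_0+a_1p+\dots+a_{\gamma-1}p^{\gamma-1}):\ \gamma\ge 1,\ a_i\in\{0,1,\dots,p-1\}\}.$$ Let $\widehat{f}$ denote the Fourier transform on $L^2(\mathbb{Q}_p)$, that is, $\widehat f(\xi)=\lim_{N\to\infty}\int_{|x|_p\le p^N}\chi_p(\xi x)f(x)\,dx$ with the limit taken in $L^2(\mathbb{Q}_p)$, where $\chi_p(x)=e^{2\pi i\{x\}_p}$ and $\{x\}_p$ is the fractional part of $x$. For a function given up to null sets, $\operatorname{supp}$ is the complement of the largest open set on which the function vanishes almost everywhere. Let $\varphi\in L^2(\mathbb{Q}_p)$ be refinable, i.e. $\varphi=\sum_{a\in I_p}\beta_a\,\varphi(p^{-1}\cdot-a)$ for some $\beta_a\in\mathbb{C}$ (a finite sum, or an infinite one converging unconditionally in $L^2$). Suppose that the system $\{\varphi(\cdot-a):a\in I_p\}$ is orthonormal in $L^2(\mathbb{Q}_p)$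 and that $\operatorname{supp}\widehat\varphi\subset B_0(0)$. For $j\in\mathbb{Z}$ put $$V_j=\overline{\operatorname{span}\{\varphi(p^{-j}\cdot-a):a\in I_p\}}\subset L^2(\mathbb{Q}_p).$$ Then $$\overline{\bigcup_{j\in\mathbb{Z}}V_j}=L^2(\mathbb{Q}_p)\quad\Longleftrightarrow\quad\bigcup_{j\in\mathbb{Z}}\operatorname{supp}\widehat\varphi(p^{j}\cdot)=\mathbb{Q}_p .$$ The same equivalence holds when the right-hand condition is read up to null sets, i.e. as: for almost every $\xi\in\mathbb{Q}_p$ there is $j\in\mathbb{Z}$ with $\widehat\varphi(p^j\xi)\ne 0$. -/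

import Mathlib

open MeasureTheory Filter Topology Metric
open scoped ENNReal

namespace PadicMRA

/-- The Borel sigma-algebra on `ℚ_[p]`. -/
noncomputable instance instMeasurableSpacePadic (p : ℕ) [Fact p.Prime] : MeasurableSpace ℚ_[p] := borel ℚ_[p]

instance instBorelSpacePadic (p : ℕ) [Fact p.Prime] : BorelSpace ℚ_[p] := ⟨rfl⟩

/-- The unit ball `B_0(0) = ℤ_p` as a compact set with nonempty interior. -/
def unitBall (p : ℕ) [Fact p.Prime] : TopologicalSpace.PositiveCompacts ℚ_[p] where
  carrier := closedBall 0 1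
  isCompact' := isCompact_closedBall 0 1
  interior_nonempty' := ⟨0, ball_subset_interior_closedBall (mem_ball_self one_pos)⟩

/-- The Haar measure on `ℚ_[p]`, normalized so that the unit ball has measure `1`. -/
noncomputable def haar (p : ℕ) [Fact p.Prime] : Measure ℚ_[p] :=
  Measure.addHaarMeasure (unitBall p)

instance instIsAddHaarMeasureHaar (p : ℕ) [Fact p.Prime] : (haar p).IsAddHaarMeasure := by
  unfold haar; infer_instance

theorem haar_closedBall_zero_one (p : ℕ) [Fact p.Prime] : haar p (closedBall 0 1) = 1 :=
  Measure.addHaarMeasure_self (K₀ := unitBall p)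

theorem haar_closedBall_mul (p : ℕ) [Fact p.Prime] (n : ℤ) :
    haar p (closedBall 0 ((p : ℝ) ^ n)) * haar p (closedBall 0 ((p : ℝ) ^ (-n))) = 1 := by
  have hp : (p : ℚ_[p]) ≠ 0 := Nat.cast_ne_zero.2 (Fact.out : p.Prime).ne_zero
  have hp0 : (0 : ℝ) < p := Nat.cast_pos.2 (Fact.out : p.Prime).pos
  have key : ∀ m : ℤ, haar p (closedBall 0 ((p : ℝ) ^ m)) =
      distribHaarChar ℚ_[p] ((Units.mk0 (p : ℚ_[p]) hp) ^ (-m)) := by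
    intro m
    have h := distribHaarChar_mul (haar p) ((Units.mk0 (p : ℚ_[p]) hp) ^ (-m)) (closedBall 0 1)
    rw [haar_closedBall_zero_one, mul_one] at h
    rw [h]
    congr 1
    ext x
    rw [Set.mem_smul_set_iff_inv_smul_mem]
    simp [Units.smul_def]
    rw [inv_mul_le_iff₀ (by positivity), mul_one]
  rw [key, key, ← ENNReal.coe_mul, ← map_mul, ← zpow_add]
  simp

/-! ### The additive character -/

/-- Every `x ∈ ℚ_p` is congruent modulo `ℤ_p` to some `m / p ^ n` with `0 ≤ m < p ^ n`. -/
theorem exists_fract (p : ℕ) [Fact p.Prime] (x : ℚ_[p]) :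
    ∃ q : ℚ, (∃ n m : ℕ, m < p ^ n ∧ q = (m : ℚ) / (p : ℚ) ^ n) ∧ ‖x - (q : ℚ_[p])‖ ≤ 1 := by
  have hp : (p : ℚ_[p]) ≠ 0 := Nat.cast_ne_zero.2 (Fact.out : p.Prime).ne_zero
  have hp1 : (1 : ℝ) < p := Nat.one_lt_cast.2 (Fact.out : p.Prime).one_lt
  have hp0 : (0 : ℝ) < p := by linarith
  obtain ⟨n, hn⟩ := pow_unbounded_of_one_lt ‖x‖ hp1
  have hz : ‖(p : ℚ_[p]) ^ n * x‖ ≤ 1 := by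
    rw [norm_mul, Padic.norm_p_pow, zpow_neg, zpow_natCast, inv_mul_le_iff₀ (by positivity)]
    linarith
  set z : ℤ_[p] := ⟨(p : ℚ_[p]) ^ n * x, hz⟩ with hzdef
  refine ⟨(z.appr n : ℚ) / (p : ℚ) ^ n, ⟨n, z.appr n, PadicInt.appr_lt z n, rfl⟩, ?_⟩
  have h := PadicInt.appr_spec n z
  rw [← PadicInt.norm_le_pow_iff_mem_span_pow, PadicInt.norm_def] at h
  have e : x - (((z.appr n : ℚ) / (p : ℚ) ^ n : ℚ) : ℚ_[p])
      = (p : ℚ_[p]) ^ (-n : ℤ) * ((z - (z.appr n : ℤ_[p]) : ℤ_[p]) : ℚ_[p]) := by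
    push_cast
    simp only [hzdef, zpow_neg, zpow_natCast]
    field_simp
  rw [e, norm_mul, Padic.norm_p_zpow, neg_neg]
  calc (p : ℝ) ^ (n : ℤ) * _ ≤ (p : ℝ) ^ (n : ℤ) * (p : ℝ) ^ (-n : ℤ) := by gcongr
    _ = 1 := by rw [← zpow_add₀ hp0.ne']; simp

/-- The fractional part `{x}_p`: the representative `m / p ^ n`, `0 ≤ m < p ^ n`, of `x` modulo
`ℤ_p` (it is unique, see `eq_intCast_of_norm_le_one`). -/
noncomputable def fract {p : ℕ} [Fact p.Prime] (x : ℚ_[p]) : ℚ := (exists_fract p x).choose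

theorem eq_intCast_of_norm_le_one {p : ℕ} [Fact p.Prime] {n : ℕ} {m : ℤ}
    (h : ‖(((m : ℚ) / (p : ℚ) ^ n : ℚ) : ℚ_[p])‖ ≤ 1) :
    ∃ k : ℤ, (m : ℚ) / (p : ℚ) ^ n = k := by
  have hp0 : (0 : ℝ) < p := Nat.cast_pos.2 (Fact.out : p.Prime).pos
  have hpq : (p : ℚ) ≠ 0 := Nat.cast_ne_zero.2 (Fact.out : p.Prime).ne_zero
  have h2 : ‖(m : ℚ_[p])‖ ≤ (p : ℝ) ^ (-n : ℤ) := by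
    push_cast at h
    rw [norm_div, norm_pow, Padic.norm_p, div_le_one (by positivity)] at h
    simpa using h
  obtain ⟨k, hk⟩ := (Padic.norm_int_le_pow_iff_dvd m n).1 h2
  refine ⟨k, ?_⟩
  rw [hk]; push_cast; field_simp

/-- The additive character `χ_p(x) = exp(2πi {x}_p)` of `ℚ_p`. -/
noncomputable def chi {p : ℕ} [Fact p.Prime] (x : ℚ_[p]) : ℂ :=
  Complex.exp (2 * Real.pi * Complex.I * (fract x : ℂ))

theorem exists_fract_eq {p : ℕ} [Fact p.Prime] (x : ℚ_[p]) :
    ∃ (n : ℕ) (m : ℤ), fract x = (m : ℚ) / (p : ℚ) ^ n := by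
  obtain ⟨⟨n, m, -, h⟩, -⟩ := (exists_fract p x).choose_spec
  exact ⟨n, m, by simpa [fract] using h⟩

theorem norm_sub_fract_le {p : ℕ} [Fact p.Prime] (x : ℚ_[p]) : ‖x - (fract x : ℚ_[p])‖ ≤ 1 :=
  (exists_fract p x).choose_spec.2

/-- A congruence modulo `ℤ_p` between `p`-adic fractions is a congruence modulo `ℤ`. -/
theorem chi_eq {p : ℕ} [Fact p.Prime] (x : ℚ_[p]) (n : ℕ) (m : ℤ)
    (h : ‖x - (((m : ℚ) / (p : ℚ) ^ n : ℚ) : ℚ_[p])‖ ≤ 1) :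
    chi x = Complex.exp (2 * Real.pi * Complex.I * (((m : ℚ) / (p : ℚ) ^ n : ℚ) : ℂ)) := by
  have hpq : (p : ℚ) ≠ 0 := Nat.cast_ne_zero.2 (Fact.out : p.Prime).ne_zero
  obtain ⟨n', m', h'⟩ := exists_fract_eq x
  have e : (fract x : ℚ) - (m : ℚ) / (p : ℚ) ^ n =
      ((m' * p ^ n - m * p ^ n' : ℤ) : ℚ) / (p : ℚ) ^ (n' + n) := by
    rw [h']; push_cast; rw [pow_add]; field_simp
  have hle : ‖((((m' * p ^ n - m * p ^ n' : ℤ) : ℚ) / (p : ℚ) ^ (n' + n) : ℚ) : ℚ_[p])‖ ≤ 1 := by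
    rw [← e]
    have : ((fract x - (m : ℚ) / (p : ℚ) ^ n : ℚ) : ℚ_[p]) =
        (x - (((m : ℚ) / (p : ℚ) ^ n : ℚ) : ℚ_[p])) + -(x - (fract x : ℚ_[p])) := by
      push_cast; ring
    rw [this]
    exact (IsUltrametricDist.norm_add_le_max _ _).trans
      (max_le h (by rw [norm_neg]; exact norm_sub_fract_le x))
  obtain ⟨k, hk⟩ := eq_intCast_of_norm_le_one hle
  rw [← e] at hk
  have hk' : fract x = (m : ℚ) / (p : ℚ) ^ n + k := by linarith
  rw [chi, hk', Complex.exp_eq_exp_iff_exists_int]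
  exact ⟨k, by push_cast; ring⟩

theorem chi_add {p : ℕ} [Fact p.Prime] (x y : ℚ_[p]) : chi (x + y) = chi x * chi y := by
  have hpq : (p : ℚ) ≠ 0 := Nat.cast_ne_zero.2 (Fact.out : p.Prime).ne_zero
  obtain ⟨n, m, h⟩ := exists_fract_eq x
  obtain ⟨n', m', h'⟩ := exists_fract_eq y
  have e : fract x + fract y = ((m * p ^ n' + m' * p ^ n : ℤ) : ℚ) / (p : ℚ) ^ (n + n') := by
    rw [h, h']; push_cast; rw [pow_add]; field_simp
  rw [chi_eq (x + y) (n + n') (m * p ^ n' + m' * p ^ n), chi, chi, ← Complex.exp_add, ← e]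
  · push_cast; ring_nf
  · rw [← e]
    have : x + y - ((fract x + fract y : ℚ) : ℚ_[p]) =
        (x - (fract x : ℚ_[p])) + (y - (fract y : ℚ_[p])) := by push_cast; ring
    rw [this]
    exact (IsUltrametricDist.norm_add_le_max _ _).trans
      (max_le (norm_sub_fract_le x) (norm_sub_fract_le y))

theorem chi_eq_one {p : ℕ} [Fact p.Prime] {x : ℚ_[p]} (h : ‖x‖ ≤ 1) : chi x = 1 := by
  rw [chi_eq x 0 0 (by simpa using h)]; simp

@[simp] theorem norm_chi {p : ℕ} [Fact p.Prime] (x : ℚ_[p]) : ‖chi x‖ = 1 := by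
  have : (2 * Real.pi * Complex.I * (fract x : ℂ) : ℂ)
      = ((2 * Real.pi * (fract x : ℝ) : ℝ) : ℂ) * Complex.I := by push_cast; ring
  rw [chi, this, Complex.norm_exp_ofReal_mul_I]

theorem chi_inv_p_ne_one (p : ℕ) [Fact p.Prime] : chi ((p : ℚ_[p])⁻¹) ≠ 1 := by
  have hp : (p : ℚ) ≠ 0 := Nat.cast_ne_zero.2 (Fact.out : p.Prime).ne_zero
  have hp1 : 1 < p := (Fact.out : p.Prime).one_lt
  rw [chi_eq _ 1 1 (by simp), Ne, Complex.exp_eq_one_iff]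
  rintro ⟨k, hk⟩
  have h2 : (2 * Real.pi * Complex.I : ℂ) ≠ 0 := by simp [Real.pi_ne_zero]
  have h3 : ((((1 : ℤ) : ℚ) / (p : ℚ) ^ 1 : ℚ) : ℂ) = ((k : ℚ) : ℂ) := by
    apply mul_left_cancel₀ h2; rw [hk]; push_cast; ring
  have h4 : ((1 : ℤ) : ℚ) / (p : ℚ) ^ 1 = (k : ℚ) := by exact_mod_cast h3
  rw [pow_one, div_eq_iff hp] at h4
  have h5 : (1 : ℤ) = k * p := by exact_mod_cast h4
  have h6 : (p : ℤ) ∣ 1 := ⟨k, by rw [h5]; ring⟩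
  have := Int.le_of_dvd one_pos h6
  omega

theorem continuous_chi (p : ℕ) [Fact p.Prime] : Continuous (chi : ℚ_[p] → ℂ) := by
  rw [continuous_iff_continuousAt]
  intro x
  have : chi =ᶠ[𝓝 x] fun _ => chi x := by
    filter_upwards [ball_mem_nhds x one_pos] with y hy
    have h1 : chi (y - x) = 1 := chi_eq_one (by rw [← dist_eq_norm]; exact (mem_ball.1 hy).le)
    rw [← sub_add_cancel y x, chi_add, h1, one_mul]
  exact (continuousAt_const.congr this.symm)


/-! ### The Fourier transform -/

/-- The Fourier integral `∫ χ_p(ξ x) f(x) dx`. -/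
noncomputable def fourierIntegral {p : ℕ} [Fact p.Prime] (f : ℚ_[p] → ℂ) (ξ : ℚ_[p]) : ℂ :=
  ∫ x, chi (ξ * x) * f x ∂(haar p)

theorem continuous_fourierIntegral {p : ℕ} [Fact p.Prime] {f : ℚ_[p] → ℂ}
    (hf : Integrable f (haar p)) : Continuous (fourierIntegral f) := by
  have hc := continuous_chi p
  refine continuous_of_dominated (bound := fun x => ‖f x‖) ?_ ?_ hf.norm ?_
  · intro ξ
    exact (hc.comp (by fun_prop)).aestronglyMeasurable.mul hf.aestronglyMeasurable
  · intro ξ; exact .of_forall fun x => by simp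
  · exact .of_forall fun x => (hc.comp (by fun_prop)).mul continuous_const

theorem enorm_setIntegral_chi_le (p : ℕ) [Fact p.Prime] (M : ℤ) (t : ℚ_[p]) :
    ‖∫ ξ in closedBall 0 ((p : ℝ) ^ M), chi (ξ * t) ∂(haar p)‖ₑ ≤
      (closedBall (0 : ℚ_[p]) ((p : ℝ) ^ (-M))).indicator
        (fun _ => haar p (closedBall 0 ((p : ℝ) ^ M))) t := by
  have hp : (p : ℚ_[p]) ≠ 0 := Nat.cast_ne_zero.2 (Fact.out : p.Prime).ne_zero
  have hp0 : (0 : ℝ) < p := Nat.cast_pos.2 (Fact.out : p.Prime).pos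
  by_cases ht : t ∈ closedBall (0 : ℚ_[p]) ((p : ℝ) ^ (-M))
  · rw [Set.indicator_of_mem ht]
    refine (enorm_integral_le_lintegral_enorm _).trans ?_
    simp [enorm_eq_nnnorm, show ∀ x : ℚ_[p], ‖chi x‖₊ = 1 from
      fun x => NNReal.eq (norm_chi x)]
  · rw [Set.indicator_of_notMem ht]
    have ht' : (p : ℝ) ^ (-M) < ‖t‖ := by simpa using ht
    have ht0 : t ≠ 0 := norm_pos_iff.1 (lt_trans (by positivity) ht')
    set η : ℚ_[p] := (p : ℚ_[p])⁻¹ * t⁻¹ with hη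
    have hηn : ‖η‖ ≤ (p : ℝ) ^ M := by
      by_contra hcon
      push Not at hcon
      rw [hη, norm_mul, norm_inv, norm_inv, Padic.norm_p, inv_inv, ← div_eq_mul_inv,
        lt_div_iff₀ (norm_pos_iff.2 ht0)] at hcon
      have h2 := (Padic.norm_le_pow_iff_norm_lt_pow_add_one t (-M)).2 (by
        rw [zpow_add₀ hp0.ne', zpow_neg, zpow_one, inv_mul_eq_div, lt_div_iff₀ (by positivity)]
        linarith)
      linarith
    have hball : ∀ ξ : ℚ_[p], ξ + η ∈ closedBall (0 : ℚ_[p]) ((p : ℝ) ^ M) ↔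
        ξ ∈ closedBall (0 : ℚ_[p]) ((p : ℝ) ^ M) := by
      intro ξ
      simp only [mem_closedBall_zero_iff]
      constructor
      · intro h
        have := (IsUltrametricDist.norm_add_le_max (ξ + η) (-η)).trans
          (max_le h (by rwa [norm_neg]))
        simpa using this
      · intro h
        exact (IsUltrametricDist.norm_add_le_max _ _).trans (max_le h hηn)
    set I := ∫ ξ in closedBall 0 ((p : ℝ) ^ M), chi (ξ * t) ∂(haar p) with hI
    have h1 : I = chi ((p : ℚ_[p])⁻¹) * I := by
      have e1 : I = ∫ ξ, (closedBall (0 : ℚ_[p]) ((p : ℝ) ^ M)).indicator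
          (fun ξ => chi (ξ * t)) ξ ∂(haar p) := by
        rw [hI, integral_indicator isClosed_closedBall.measurableSet]
      rw [e1]
      conv_lhs => rw [← integral_add_right_eq_self _ η]
      rw [← integral_const_mul]
      congr 1
      ext ξ
      by_cases h : ξ ∈ closedBall (0 : ℚ_[p]) ((p : ℝ) ^ M)
      · rw [Set.indicator_of_mem h, Set.indicator_of_mem ((hball ξ).2 h), add_mul, chi_add,
          hη, mul_assoc, inv_mul_cancel₀ ht0, mul_one, mul_comm]
      · rw [Set.indicator_of_notMem h, Set.indicator_of_notMem (fun h' => h ((hball ξ).1 h')),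
          mul_zero]
    have h2 : (1 - chi ((p : ℚ_[p])⁻¹)) * I = 0 := by linear_combination h1
    rcases mul_eq_zero.1 h2 with h | h
    · exact absurd (sub_eq_zero.1 h).symm (chi_inv_p_ne_one p)
    · simp [h]

theorem setLIntegral_fourierIntegral_le {p : ℕ} [Fact p.Prime] {f : ℚ_[p] → ℂ}
    (hf : Integrable f (haar p)) (M : ℤ) :
    ∫⁻ ξ in closedBall 0 ((p : ℝ) ^ M), ‖fourierIntegral f ξ‖ₑ ^ 2 ∂(haar p) ≤
      ∫⁻ x, ‖f x‖ₑ ^ 2 ∂(haar p) := by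
  have hc := continuous_chi p
  set μ := haar p with hμ
  set B := closedBall (0 : ℚ_[p]) ((p : ℝ) ^ M) with hB
  set K := closedBall (0 : ℚ_[p]) ((p : ℝ) ^ (-M)) with hK
  have hKm : MeasurableSet K := isClosed_closedBall.measurableSet
  have hBfin : μ B ≠ ∞ := (isCompact_closedBall _ _).measure_lt_top.ne
  have : IsFiniteMeasure (μ.restrict B) := ⟨by simpa using hBfin.lt_top⟩
  have hFc := continuous_fourierIntegral hf
  have hfm := hf.aestronglyMeasurable
  -- the square of the Fourier integral as a double integral
  have hsq : ∀ ξ, (fourierIntegral f ξ) * (starRingEnd ℂ) (fourierIntegral f ξ) =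
      ∫ z : ℚ_[p] × ℚ_[p], chi (ξ * (z.1 - z.2)) * (f z.1 * (starRingEnd ℂ) (f z.2))
        ∂(μ.prod μ) := by
    intro ξ
    rw [fourierIntegral, ← integral_conj, ← integral_prod_mul]
    congr 1
    ext z
    have h1 : (starRingEnd ℂ) (chi (ξ * z.2)) = chi (-(ξ * z.2)) := by
      have h2 : chi (ξ * z.2) * chi (-(ξ * z.2)) = 1 := by
        rw [← chi_add, add_neg_cancel, chi_eq_one (by simp)]
      have h3 : chi (ξ * z.2) * (starRingEnd ℂ) (chi (ξ * z.2)) = 1 := by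
        rw [Complex.mul_conj, Complex.normSq_eq_norm_sq, norm_chi]; simp
      have h4 : chi (ξ * z.2) ≠ 0 := by
        intro h; rw [h, zero_mul] at h2; exact zero_ne_one h2
      exact mul_left_cancel₀ h4 (h3.trans h2.symm)
    rw [map_mul, h1, mul_sub, sub_eq_add_neg, chi_add]
    ring
  have hprod : Integrable (fun z : ℚ_[p] × ℚ_[p] => f z.1 * (starRingEnd ℂ) (f z.2))
      (μ.prod μ) := hf.mul_prod (RCLike.conjCLE.integrable_comp_iff.2 hf)
  have hint : Integrable (Function.uncurry fun (ξ : ℚ_[p]) (z : ℚ_[p] × ℚ_[p]) =>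
      chi (ξ * (z.1 - z.2)) * (f z.1 * (starRingEnd ℂ) (f z.2)))
      ((μ.restrict B).prod (μ.prod μ)) := by
    have h1 := (hprod.comp_snd (μ.restrict B))
    refine h1.bdd_mul (c := 1) ?_ (.of_forall fun z => by simp)
    exact (hc.comp (by fun_prop)).aestronglyMeasurable
  have h1 : ∫ ξ in B, (fourierIntegral f ξ) * (starRingEnd ℂ) (fourierIntegral f ξ) ∂μ =
      ∫ z : ℚ_[p] × ℚ_[p], (∫ ξ in B, chi (ξ * (z.1 - z.2)) ∂μ) *
        (f z.1 * (starRingEnd ℂ) (f z.2)) ∂(μ.prod μ) := by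
    simp_rw [hsq]
    rw [integral_integral_swap hint]
    simp_rw [integral_mul_const]
  have h2 : ∫⁻ ξ in B, ‖fourierIntegral f ξ‖ₑ ^ 2 ∂μ =
      ‖∫ ξ in B, (fourierIntegral f ξ) * (starRingEnd ℂ) (fourierIntegral f ξ) ∂μ‖ₑ := by
    have e1 : ∀ ξ, (fourierIntegral f ξ) * (starRingEnd ℂ) (fourierIntegral f ξ) =
        ((‖fourierIntegral f ξ‖ ^ 2 : ℝ) : ℂ) := fun ξ => by
      rw [Complex.mul_conj, Complex.normSq_eq_norm_sq]
    simp_rw [e1]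
    rw [integral_complex_ofReal]
    have hint2 : IntegrableOn (fun ξ => ‖fourierIntegral f ξ‖ ^ 2) B μ :=
      (hFc.norm.pow 2).continuousOn.integrableOn_compact (isCompact_closedBall _ _)
    have e2 : ‖((∫ ξ in B, ‖fourierIntegral f ξ‖ ^ 2 ∂μ : ℝ) : ℂ)‖ₑ =
        ENNReal.ofReal (∫ ξ in B, ‖fourierIntegral f ξ‖ ^ 2 ∂μ) := by
      rw [← ofReal_norm, Complex.norm_real, Real.norm_of_nonneg]
      exact integral_nonneg fun _ => by positivity
    rw [e2, ofReal_integral_eq_lintegral_ofReal hint2 (.of_forall fun _ => by positivity)]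
    refine lintegral_congr fun ξ => ?_
    rw [ENNReal.ofReal_pow (norm_nonneg _), ofReal_norm]
  rw [h2, h1]
  set c := μ B with hcdef
  have hcK : c * μ K = 1 := haar_closedBall_mul p M
  have hfe : AEMeasurable (fun x => ‖f x‖ₑ) μ := hfm.enorm
  have hfe1 : AEMeasurable (fun z : ℚ_[p] × ℚ_[p] => ‖f z.1‖ₑ) (μ.prod μ) := hfe.comp_fst
  have hfe2 : AEMeasurable (fun z : ℚ_[p] × ℚ_[p] => ‖f z.2‖ₑ) (μ.prod μ) := hfe.comp_snd
  have hind : Measurable (fun z : ℚ_[p] × ℚ_[p] => K.indicator (fun _ => c) (z.1 - z.2)) :=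
    (measurable_const.indicator hKm).comp (by fun_prop)
  have hm1 : AEMeasurable (fun z : ℚ_[p] × ℚ_[p] =>
      K.indicator (fun _ => c) (z.1 - z.2) * ‖f z.1‖ₑ ^ 2) (μ.prod μ) :=
    hind.aemeasurable.mul (hfe1.pow_const 2)
  have hm2 : AEMeasurable (fun z : ℚ_[p] × ℚ_[p] =>
      K.indicator (fun _ => c) (z.1 - z.2) * ‖f z.2‖ₑ ^ 2) (μ.prod μ) :=
    hind.aemeasurable.mul (hfe2.pow_const 2)
  have hcalc1 : ∫⁻ z : ℚ_[p] × ℚ_[p], K.indicator (fun _ => c) (z.1 - z.2) * ‖f z.1‖ₑ ^ 2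
      ∂(μ.prod μ) = ∫⁻ x, ‖f x‖ₑ ^ 2 ∂μ := by
    rw [lintegral_prod _ hm1]
    refine lintegral_congr fun x => ?_
    dsimp only
    rw [lintegral_mul_const' _ _ (by simp)]
    rw [lintegral_sub_left_eq_self (fun y => K.indicator (fun _ => c) y) x,
      lintegral_indicator hKm, setLIntegral_const, hcK, one_mul]
  have hcalc2 : ∫⁻ z : ℚ_[p] × ℚ_[p], K.indicator (fun _ => c) (z.1 - z.2) * ‖f z.2‖ₑ ^ 2
      ∂(μ.prod μ) = ∫⁻ x, ‖f x‖ₑ ^ 2 ∂μ := by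
    rw [lintegral_prod_symm _ hm2]
    refine lintegral_congr fun x => ?_
    dsimp only
    rw [lintegral_mul_const' _ _ (by simp)]
    rw [lintegral_sub_right_eq_self (fun y => K.indicator (fun _ => c) y) x,
      lintegral_indicator hKm, setLIntegral_const, hcK, one_mul]
  have hamgm : ∀ a b : ℂ, ‖a‖ₑ * ‖b‖ₑ ≤ 2⁻¹ * (‖a‖ₑ ^ 2 + ‖b‖ₑ ^ 2) := by
    intro a b
    have h : 2 * (‖a‖ₑ * ‖b‖ₑ) ≤ ‖a‖ₑ ^ 2 + ‖b‖ₑ ^ 2 := by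
      have h0 := two_mul_le_add_sq ‖a‖₊ ‖b‖₊
      rw [mul_assoc] at h0
      simp only [enorm_eq_nnnorm]
      exact_mod_cast h0
    calc ‖a‖ₑ * ‖b‖ₑ = 2⁻¹ * (2 * (‖a‖ₑ * ‖b‖ₑ)) := by
          rw [← mul_assoc, ENNReal.inv_mul_cancel (by simp) (by simp), one_mul]
      _ ≤ _ := by gcongr
  have hm12 : AEMeasurable (fun z : ℚ_[p] × ℚ_[p] =>
      K.indicator (fun _ => c) (z.1 - z.2) * ‖f z.1‖ₑ ^ 2 +
        K.indicator (fun _ => c) (z.1 - z.2) * ‖f z.2‖ₑ ^ 2) (μ.prod μ) := hm1.add hm2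
  calc ‖∫ z : ℚ_[p] × ℚ_[p], (∫ ξ in B, chi (ξ * (z.1 - z.2)) ∂μ) *
        (f z.1 * (starRingEnd ℂ) (f z.2)) ∂(μ.prod μ)‖ₑ
      ≤ ∫⁻ z : ℚ_[p] × ℚ_[p], ‖(∫ ξ in B, chi (ξ * (z.1 - z.2)) ∂μ) *
        (f z.1 * (starRingEnd ℂ) (f z.2))‖ₑ ∂(μ.prod μ) := enorm_integral_le_lintegral_enorm _
    _ ≤ ∫⁻ z : ℚ_[p] × ℚ_[p], 2⁻¹ * (K.indicator (fun _ => c) (z.1 - z.2) * ‖f z.1‖ₑ ^ 2 +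
          K.indicator (fun _ => c) (z.1 - z.2) * ‖f z.2‖ₑ ^ 2) ∂(μ.prod μ) := by
        refine lintegral_mono fun z => ?_
        dsimp only
        rw [← mul_add, mul_left_comm 2⁻¹, enorm_mul, enorm_mul, RCLike.enorm_conj]
        exact mul_le_mul' (enorm_setIntegral_chi_le p M _) (hamgm _ _)
    _ = ∫⁻ x, ‖f x‖ₑ ^ 2 ∂μ := by
        rw [lintegral_const_mul'' _ hm12, lintegral_add_left' hm1, hcalc1, hcalc2,
          ← two_mul, ← mul_assoc, ENNReal.inv_mul_cancel (by simp) (by simp), one_mul]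

/-- The Hilbert space `L²(ℚ_p)`. -/
abbrev L2 (p : ℕ) [Fact p.Prime] : Type := Lp ℂ 2 (haar p)

theorem eLpNorm_two_sq {p : ℕ} [Fact p.Prime] (f : ℚ_[p] → ℂ) :
    eLpNorm f 2 (haar p) = (∫⁻ x, ‖f x‖ₑ ^ 2 ∂(haar p)) ^ (1 / 2 : ℝ) := by
  rw [eLpNorm_eq_lintegral_rpow_enorm_toReal (by simp) (by simp)]
  simp

theorem eLpNorm_fourierIntegral_le {p : ℕ} [Fact p.Prime] {f : ℚ_[p] → ℂ}
    (hf : Integrable f (haar p)) :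
    eLpNorm (fourierIntegral f) 2 (haar p) ≤ eLpNorm f 2 (haar p) := by
  rw [eLpNorm_two_sq, eLpNorm_two_sq]
  refine ENNReal.rpow_le_rpow ?_ (by norm_num)
  have hp1 : (1 : ℝ) < p := Nat.one_lt_cast.2 (Fact.out : p.Prime).one_lt
  have hU : (⋃ M : ℕ, closedBall (0 : ℚ_[p]) ((p : ℝ) ^ (M : ℤ))) = Set.univ := by
    refine Set.eq_univ_of_forall fun x => Set.mem_iUnion.2 ?_
    obtain ⟨n, hn⟩ := pow_unbounded_of_one_lt ‖x‖ hp1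
    exact ⟨n, by simpa using hn.le⟩
  rw [← setLIntegral_univ, ← hU, setLIntegral_iUnion_of_directed]
  · exact iSup_le fun M => setLIntegral_fourierIntegral_le hf M
  · refine (monotone_nat_of_le_succ fun n => closedBall_subset_closedBall ?_).directed_le
    exact zpow_le_zpow_right₀ hp1.le (by simp)

/-- The restriction of `f` to the ball `B_N(0)`. -/
noncomputable def cut {p : ℕ} [Fact p.Prime] (f : L2 p) (N : ℕ) : ℚ_[p] → ℂ :=
  (closedBall (0 : ℚ_[p]) ((p : ℝ) ^ N)).indicator f

theorem memLp_cut {p : ℕ} [Fact p.Prime] (f : L2 p) (N : ℕ) : MemLp (cut f N) 2 (haar p) :=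
  (Lp.memLp f).indicator isClosed_closedBall.measurableSet

theorem integrable_cut {p : ℕ} [Fact p.Prime] (f : L2 p) (N : ℕ) :
    Integrable (cut f N) (haar p) := by
  refine (integrable_indicator_iff isClosed_closedBall.measurableSet).2 ?_
  have : IsFiniteMeasure ((haar p).restrict (closedBall (0 : ℚ_[p]) ((p : ℝ) ^ N))) :=
    ⟨by simpa using (isCompact_closedBall _ _).measure_lt_top⟩
  exact ((Lp.memLp f).restrict _).integrable (by norm_num)

theorem memLp_fourierIntegral_cut {p : ℕ} [Fact p.Prime] (f : L2 p) (N : ℕ) :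
    MemLp (fourierIntegral (cut f N)) 2 (haar p) :=
  ⟨(continuous_fourierIntegral (integrable_cut f N)).aestronglyMeasurable,
    (eLpNorm_fourierIntegral_le (integrable_cut f N)).trans_lt (memLp_cut f N).2⟩

/-- The Fourier integral over the ball `B_N(0)`, `ξ ↦ ∫_{|x| ≤ p ^ N} χ_p(ξ x) f(x) dx`, as an
element of `L²(ℚ_p)`. -/
noncomputable def truncFourier {p : ℕ} [Fact p.Prime] (f : L2 p) (N : ℕ) : L2 p :=
  (memLp_fourierIntegral_cut f N).toLp

/-- The Fourier transform on `L²(ℚ_p)`: the limit in `L²(ℚ_p)`, as `N → ∞`, of the Fourier integrals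
over the balls `B_N(0)`. The limit exists by `tendsto_truncFourier`. -/
noncomputable def fourierL2 {p : ℕ} [Fact p.Prime] (f : L2 p) : L2 p :=
  limUnder atTop (truncFourier f)

theorem tendsto_cut {p : ℕ} [Fact p.Prime] (f : L2 p) :
    Tendsto (fun N => (memLp_cut f N).toLp) atTop (𝓝 f) := by
  have hp1 : (1 : ℝ) < p := Nat.one_lt_cast.2 (Fact.out : p.Prime).one_lt
  have hf2 : ∫⁻ x, ‖f x‖ₑ ^ 2 ∂(haar p) ≠ ∞ := by
    have h := (Lp.memLp f).2
    rw [eLpNorm_two_sq] at h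
    exact ((ENNReal.rpow_lt_top_iff_of_pos (by norm_num)).1 h).ne
  have hfm := (Lp.memLp f).1
  rw [show (𝓝 f) = 𝓝 ((Lp.memLp f).toLp) by rw [Lp.toLp_coeFn], Lp.tendsto_Lp_iff_tendsto_eLpNorm'']
  simp_rw [eLpNorm_two_sq]
  have h0 : (0 : ℝ≥0∞) = 0 ^ (1 / 2 : ℝ) := by simp
  rw [h0]
  refine (ENNReal.continuous_rpow_const.tendsto _).comp ?_
  have hlim := tendsto_lintegral_of_dominated_convergence' (μ := haar p)
    (F := fun N x => ‖(cut f N - f) x‖ₑ ^ 2) (f := fun _ => 0) (fun x => ‖f x‖ₑ ^ 2)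
    (fun N => ((memLp_cut f N).1.sub hfm).enorm.pow_const 2)
    (fun N => .of_forall fun x => ?_) hf2 (.of_forall fun x => ?_)
  · simpa using hlim
  · by_cases hx : x ∈ closedBall (0 : ℚ_[p]) ((p : ℝ) ^ N) <;> simp [cut, hx]
  · obtain ⟨n, hn⟩ := pow_unbounded_of_one_lt ‖x‖ hp1
    refine tendsto_const_nhds.congr' ?_
    filter_upwards [eventually_ge_atTop n] with N hN
    have hx : x ∈ closedBall (0 : ℚ_[p]) ((p : ℝ) ^ N) := by
      simpa using hn.le.trans (pow_le_pow_right₀ hp1.le hN)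
    simp [cut, hx]

theorem norm_truncFourier_sub_le {p : ℕ} [Fact p.Prime] (f : L2 p) (M N : ℕ) :
    ‖truncFourier f M - truncFourier f N‖ ≤
      ‖(memLp_cut f M).toLp - (memLp_cut f N).toLp‖ := by
  rw [truncFourier, truncFourier, ← MemLp.toLp_sub, ← MemLp.toLp_sub, Lp.norm_toLp, Lp.norm_toLp]
  have e : fourierIntegral (cut f M) - fourierIntegral (cut f N) =
      fourierIntegral (cut f M - cut f N) := by
    ext ξ
    have hi : ∀ K, Integrable (fun x => chi (ξ * x) * cut f K x) (haar p) := fun K =>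
      (integrable_cut f K).bdd_mul (c := 1)
        ((continuous_chi p).comp (by fun_prop)).aestronglyMeasurable
        (.of_forall fun x => by simp)
    simp only [Pi.sub_apply, fourierIntegral, mul_sub]
    rw [integral_sub (hi M) (hi N)]
  rw [e]
  exact ENNReal.toReal_mono ((memLp_cut f M).sub (memLp_cut f N)).2.ne
    (eLpNorm_fourierIntegral_le ((integrable_cut f M).sub (integrable_cut f N)))

theorem tendsto_truncFourier {p : ℕ} [Fact p.Prime] (f : L2 p) :
    Tendsto (truncFourier f) atTop (𝓝 (fourierL2 f)) := by
  refine CauchySeq.tendsto_limUnder (Metric.cauchySeq_iff.2 fun ε hε => ?_)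
  obtain ⟨N, hN⟩ := Metric.cauchySeq_iff.1 (tendsto_cut f).cauchySeq ε hε
  refine ⟨N, fun m hm n hn => lt_of_le_of_lt ?_ (hN m hm n hn)⟩
  rw [dist_eq_norm, dist_eq_norm]
  exact norm_truncFourier_sub_le f m n

/-! ### Shifts, dilations and the spaces `V_j` -/

theorem memLp_atom {p : ℕ} [Fact p.Prime] (φ : L2 p) (j : ℤ) (a : ℚ_[p]) :
    MemLp (fun x => φ ((p : ℚ_[p]) ^ (-j) * x - a)) 2 (haar p) := by
  have hp : (p : ℚ_[p]) ≠ 0 := Nat.cast_ne_zero.2 (Fact.out : p.Prime).ne_zero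
  have h1 : MemLp (fun x => φ (x - a)) 2 (haar p) :=
    (Lp.memLp φ).comp_measurePreserving (measurePreserving_sub_right (haar p) a)
  set u : ℚ_[p]ˣ := (Units.mk0 (p : ℚ_[p]) hp) ^ (-j) with hu
  have hmeas : Measurable fun x : ℚ_[p] => u • x := (continuous_const_smul u).measurable
  have h2 : MemLp (fun x => φ (x - a)) 2 ((haar p).map fun x => u • x) := by
    have : ((haar p).map fun x => u • x).IsAddHaarMeasure :=
      (DistribMulAction.toAddEquiv ℚ_[p] u).isAddHaarMeasure_map (haar p)
        (continuous_const_smul u) (continuous_const_smul u⁻¹)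
    rw [Measure.isAddLeftInvariant_eq_smul ((haar p).map fun x => u • x) (haar p)]
    exact h1.smul_measure ENNReal.coe_ne_top
  have h3 := h2.comp_of_map hmeas.aemeasurable
  refine (memLp_congr_ae (.of_forall fun x => ?_)).1 h3
  simp [hu, Units.smul_def]

/-- The function `x ↦ φ(p ^ (-j) x - a)` as an element of `L²(ℚ_p)`. -/
noncomputable def atom {p : ℕ} [Fact p.Prime] (φ : L2 p) (j : ℤ) (a : ℚ_[p]) : L2 p :=
  (memLp_atom φ j a).toLp

/-- The set of shifts `I_p`: all `a = p ^ (-γ) * (a_0 + a_1 p + ⋯ + a_{γ-1} p ^ (γ-1))` with `γ ≥ 1`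
and digits `0 ≤ a_i < p`. -/
def shifts (p : ℕ) [Fact p.Prime] : Set ℚ_[p] :=
  {a | ∃ γ : ℕ, 1 ≤ γ ∧ ∃ d : ℕ → ℕ, (∀ i, d i < p) ∧
    a = (p : ℚ_[p]) ^ (-(γ : ℤ)) * ∑ i ∈ Finset.range γ, (d i : ℚ_[p]) * (p : ℚ_[p]) ^ i}

/-- `φ` is refinable: `φ = ∑_{a ∈ I_p} β_a φ(p⁻¹ · - a)` for some `β_a ∈ ℂ`, with convergence in
`L²(ℚ_p)`. Equations with finitely many terms are the case of a finitely supported `β`. -/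
def IsRefinable {p : ℕ} [Fact p.Prime] (φ : L2 p) : Prop :=
  ∃ β : shifts p → ℂ, HasSum (fun a : shifts p => β a • atom φ 1 a) φ

/-- The space `V_j`, the closed linear span of the functions `φ(p ^ (-j) · - a)`, `a ∈ I_p`. -/
noncomputable def V {p : ℕ} [Fact p.Prime] (φ : L2 p) (j : ℤ) : Submodule ℂ (L2 p) :=
  (Submodule.span ℂ (Set.range fun a : shifts p => atom φ j a)).topologicalClosure

/-- The support of a function given up to null sets (the complement of the largest open set on
which `f` vanishes almost everywhere). -/
def essSupport {p : ℕ} [Fact p.Prime] (f : ℚ_[p] → ℂ) : Set ℚ_[p] :=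
  {x | ∀ U ∈ 𝓝 x, haar p {y ∈ U | f y ≠ 0} ≠ 0}

end PadicMRA

namespace PadicMRA
variable {p : ℕ} [Fact p.Prime]

/-! Under the hypotheses both sides of the equivalence are true, in either reading of the right-hand
one, so each is proved outright.

Characters `chi (ξ * h)` with `ξ` and `h` in the unit ball are trivial. A function whose Fourier
transform lives on the unit ball is therefore `ℤ_p`-periodic (`exists_invariant_representative`):
`φ` is constant on cosets of `ℤ_p`, and `I_p` meets each coset exactly once. The coefficients of the
indicator of a unit ball `b + ℤ_p` against the shifts of `φ` have moduli `|φ(b - a)|`, and their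
squares sum over `a ∈ I_p` to `‖φ‖² = 1`, the squared norm of the indicator. Equality in Bessel's
inequality puts the indicator in `V_0` (`ballInd_one_mem_V`).

Density: `V_0` then contains every `ℤ_p`-periodic function, and by dilation `V_j` contains every
function periodic under `p ^ j ℤ_p`. The latter include the indicators of all balls of radius `p ^
(-j)`, and only `0` is orthogonal to all indicators of small balls.

Covering: Fourier transforms of elements of `V_0` vanish wherever that of `φ` does, while the
indicator of `ℤ_p` lies in `V_0` and is its own transform. Hence the transform of `φ` is nonzero
almost everywhere on the unit ball (`fourierL2_ne_zero_of_ballInd_mem_V`), and dilates of that ball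
exhaust `ℚ_p`. -/

/-! ### Balls in `ℚ_p` and functions determined by their integrals over balls -/

theorem one_lt_p (p : ℕ) [Fact p.Prime] : (1 : ℝ) < p :=
  Nat.one_lt_cast.2 (Fact.out : p.Prime).one_lt

theorem p_ne_zero (p : ℕ) [Fact p.Prime] : (p : ℚ_[p]) ≠ 0 :=
  Nat.cast_ne_zero.2 (Fact.out : p.Prime).ne_zero

theorem zpow_pos_p (p : ℕ) [Fact p.Prime] (n : ℤ) : (0 : ℝ) < (p : ℝ) ^ n :=
  zpow_pos (zero_lt_one.trans (one_lt_p p)) n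

theorem haar_closedBall_ne_top (x : ℚ_[p]) (r : ℝ) : haar p (closedBall x r) ≠ ∞ :=
  (isCompact_closedBall x r).measure_lt_top.ne

theorem isOpen_closedBall_zpow (x : ℚ_[p]) (n : ℤ) : IsOpen (closedBall x ((p : ℝ) ^ n)) :=
  IsUltrametricDist.isOpen_closedBall x (zpow_pos_p p n).ne'

theorem exists_zpow_neg_lt (p : ℕ) [Fact p.Prime] {ε : ℝ} (hε : 0 < ε) :
    ∃ n : ℕ, (p : ℝ) ^ (-(n : ℤ)) < ε := by
  obtain ⟨n, hn⟩ := exists_pow_lt_of_lt_one hε (inv_lt_one_of_one_lt₀ (one_lt_p p))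
  exact ⟨n, by simpa [zpow_neg] using hn⟩

/-- The balls of radius `p ^ (-n)`, `n ≥ 0`. -/
def smallBalls (p : ℕ) [Fact p.Prime] : Set (Set ℚ_[p]) :=
  {s | ∃ (x : ℚ_[p]) (n : ℕ), s = closedBall x ((p : ℝ) ^ (-(n : ℤ)))}

theorem isTopologicalBasis_smallBalls (p : ℕ) [Fact p.Prime] :
    TopologicalSpace.IsTopologicalBasis (smallBalls p) := by
  refine TopologicalSpace.isTopologicalBasis_of_isOpen_of_nhds ?_ fun x U hx hU => ?_
  · rintro _ ⟨x, n, rfl⟩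
    exact isOpen_closedBall_zpow x _
  · obtain ⟨ε, hε, h⟩ := Metric.isOpen_iff.1 hU x hx
    obtain ⟨n, hn⟩ := exists_zpow_neg_lt p hε
    exact ⟨_, ⟨x, n, rfl⟩, mem_closedBall_self (zpow_pos_p p _).le,
      (closedBall_subset_ball hn).trans h⟩

theorem isPiSystem_smallBalls (p : ℕ) [Fact p.Prime] : IsPiSystem (smallBalls p) := by
  rintro _ ⟨x, n, rfl⟩ _ ⟨y, m, rfl⟩ hne
  rcases IsUltrametricDist.closedBall_subset_trichotomy (x := x) (y := y)
    (r := (p : ℝ) ^ (-(n : ℤ))) (s := (p : ℝ) ^ (-(m : ℤ))) with h | h | h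
  · rw [Set.inter_eq_left.2 h]; exact ⟨x, n, rfl⟩
  · rw [Set.inter_eq_right.2 h]; exact ⟨y, m, rfl⟩
  · exact absurd h (Set.not_disjoint_iff_nonempty_inter.2 hne)

/-- A locally integrable function whose integral over every small ball vanishes is zero. -/
theorem ae_eq_zero_of_forall_setIntegral_closedBall {g : ℚ_[p] → ℂ}
    (hg : ∀ x, IntegrableOn g (closedBall x 1) (haar p))
    (h0 : ∀ (x : ℚ_[p]) (n : ℕ), ∫ y in closedBall x ((p : ℝ) ^ (-(n : ℤ))), g y ∂(haar p) = 0) :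
    g =ᵐ[haar p] 0 := by
  -- Small balls form a generating π-system, so the vanishing extends to all Borel sets by π-λ
  -- induction. Working inside one unit ball supplies the integrability needed for complements and
  -- disjoint unions.
  have key : ∀ x : ℚ_[p], ∀ s, MeasurableSet s → ∫ y in s ∩ closedBall x 1, g y ∂(haar p) = 0 := by
    intro x
    have hB : MeasurableSet (closedBall x 1) := isClosed_closedBall.measurableSet
    refine MeasurableSpace.induction_on_inter (s := smallBalls p) ?_ (isPiSystem_smallBalls p)
      ?_ ?_ ?_ ?_
    · exact (isTopologicalBasis_smallBalls p).borel_eq_generateFrom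
    · simp
    · rintro _ ⟨y, n, rfl⟩
      rcases IsUltrametricDist.closedBall_subset_trichotomy (x := x) (y := y)
        (r := 1) (s := (p : ℝ) ^ (-(n : ℤ))) with h | h | h
      · rw [Set.inter_eq_right.2 h]; simpa using h0 x 0
      · rw [Set.inter_eq_left.2 h]; exact h0 y n
      · rw [Set.disjoint_iff_inter_eq_empty.1 h.symm]; simp
    · intro t ht h
      have h1 := integral_inter_add_sdiff ht (hg x)
      rw [Set.inter_comm, h, zero_add] at h1
      rw [Set.inter_comm, ← Set.sdiff_eq, h1]
      simpa using h0 x 0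
    · intro f hf hfm h
      rw [Set.iUnion_inter, integral_iUnion (fun i => (hfm i).inter hB)]
      · simp [h]
      · exact fun i j hij => (hf hij).mono Set.inter_subset_left Set.inter_subset_left
      · exact (hg x).mono_set (by simp)
  have hloc : ∀ x : ℚ_[p], ∀ᵐ y ∂(haar p).restrict (closedBall x 1), g y = 0 := by
    intro x
    refine Integrable.ae_eq_zero_of_forall_setIntegral_eq_zero (hg x) fun s hs _ => ?_
    rw [Measure.restrict_restrict hs]
    exact key x s hs
  refine measure_null_of_locally_null _ fun x _ => ?_
  refine ⟨{y | ¬ g y = 0} ∩ closedBall x 1, ?_, ?_⟩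
  · exact inter_mem_nhdsWithin _ (closedBall_mem_nhds x one_pos)
  · have := hloc x
    rw [ae_iff, Measure.restrict_apply' isClosed_closedBall.measurableSet] at this
    exact this

theorem integrableOn_closedBall (f : L2 p) (x : ℚ_[p]) (r : ℝ) :
    IntegrableOn f (closedBall x r) (haar p) :=
  integrableOn_Lp_of_measure_ne_top f (by norm_num) (haar_closedBall_ne_top x r)

/-- The indicator function of a ball as an element of `L²(ℚ_p)`. -/
noncomputable def ballInd (x : ℚ_[p]) (r : ℝ) : L2 p :=
  indicatorConstLp 2 (isClosed_closedBall (x := x) (ε := r)).measurableSet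
    (haar_closedBall_ne_top x r) (1 : ℂ)

theorem inner_ballInd (x : ℚ_[p]) (r : ℝ) (f : L2 p) :
    inner ℂ (ballInd x r) f = ∫ y in closedBall x r, f y ∂(haar p) :=
  L2.inner_indicatorConstLp_one _ _ f

theorem ballInd_coeFn (x : ℚ_[p]) (r : ℝ) :
    (ballInd x r : ℚ_[p] → ℂ) =ᵐ[haar p] (closedBall x r).indicator 1 :=
  indicatorConstLp_coeFn

/-! ### The Fourier transform on `L²` -/

theorem integrable_chi_mul {f : ℚ_[p] → ℂ} (hf : Integrable f (haar p)) (ξ : ℚ_[p]) :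
    Integrable (fun x => chi (ξ * x) * f x) (haar p) :=
  hf.bdd_mul (c := 1) ((continuous_chi p).comp (by fun_prop)).aestronglyMeasurable
    (.of_forall fun x => by simp)

theorem chi_neg (x : ℚ_[p]) : chi (-x) = (starRingEnd ℂ) (chi x) := by
  have h2 : chi x * chi (-x) = 1 := by rw [← chi_add, add_neg_cancel, chi_eq_one (by simp)]
  have h3 : chi x * (starRingEnd ℂ) (chi x) = 1 := by
    rw [Complex.mul_conj, Complex.normSq_eq_norm_sq, norm_chi]; simp
  have h4 : chi x ≠ 0 := by
    intro h; rw [h, zero_mul] at h2; exact zero_ne_one h2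
  exact mul_left_cancel₀ h4 (h2.trans h3.symm)

/-- Orthogonality of characters: `ξ ↦ chi (ξ * t)` is trivial on the ball when `t` lies in the dual
ball, and otherwise it is a nontrivial character of a compact group, with integral zero. -/
theorem setIntegral_chi (M : ℤ) (t : ℚ_[p]) :
    ∫ ξ in closedBall 0 ((p : ℝ) ^ M), chi (ξ * t) ∂(haar p) =
      (closedBall (0 : ℚ_[p]) ((p : ℝ) ^ (-M))).indicator
        (fun _ => ((haar p).real (closedBall 0 ((p : ℝ) ^ M)) : ℂ)) t := by
  by_cases ht : t ∈ closedBall (0 : ℚ_[p]) ((p : ℝ) ^ (-M))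
  · rw [Set.indicator_of_mem ht]
    have : ∀ ξ ∈ closedBall (0 : ℚ_[p]) ((p : ℝ) ^ M), chi (ξ * t) = 1 := by
      intro ξ hξ
      refine chi_eq_one ?_
      rw [mem_closedBall_zero_iff] at ht hξ
      rw [norm_mul]
      refine (mul_le_mul hξ ht (norm_nonneg _) (zpow_pos_p p _).le).trans ?_
      rw [← zpow_add₀ (zero_lt_one.trans (one_lt_p p)).ne']; simp
    rw [setIntegral_congr_fun isClosed_closedBall.measurableSet this]
    simp
  · have := enorm_setIntegral_chi_le p M t
    rw [Set.indicator_of_notMem ht] at this ⊢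
    simpa using this

theorem fourierIntegral_add {f g : ℚ_[p] → ℂ} (hf : Integrable f (haar p))
    (hg : Integrable g (haar p)) :
    fourierIntegral (f + g) = fourierIntegral f + fourierIntegral g := by
  ext ξ
  simp only [Pi.add_apply, fourierIntegral, mul_add]
  exact integral_add (integrable_chi_mul hf ξ) (integrable_chi_mul hg ξ)

theorem fourierIntegral_smul (c : ℂ) (f : ℚ_[p] → ℂ) :
    fourierIntegral (c • f) = c • fourierIntegral f := by
  ext ξ
  simp only [Pi.smul_apply, fourierIntegral, smul_eq_mul]
  rw [← integral_const_mul]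
  congr 1; ext x; ring

theorem fourierIntegral_congr_ae {f g : ℚ_[p] → ℂ} (h : f =ᵐ[haar p] g) :
    fourierIntegral f = fourierIntegral g := by
  ext ξ
  exact integral_congr_ae (h.mono fun x hx => by simp [hx])

theorem cut_ae_eq {f : L2 p} {g : ℚ_[p] → ℂ} (h : f =ᵐ[haar p] g) (N : ℕ) :
    cut f N =ᵐ[haar p] (closedBall (0 : ℚ_[p]) ((p : ℝ) ^ N)).indicator g :=
  h.mono fun x hx => by simp [cut, Set.indicator, hx]

theorem truncFourier_coeFn (f : L2 p) (N : ℕ) :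
    truncFourier f N =ᵐ[haar p] fourierIntegral (cut f N) := MemLp.coeFn_toLp _

theorem truncFourier_add (f g : L2 p) (N : ℕ) :
    truncFourier (f + g) N = truncFourier f N + truncFourier g N := by
  rw [truncFourier, truncFourier, truncFourier, ← MemLp.toLp_add]
  congr 1
  rw [← fourierIntegral_add (integrable_cut f N) (integrable_cut g N)]
  refine fourierIntegral_congr_ae ((cut_ae_eq (Lp.coeFn_add f g) N).trans (.of_forall fun x => ?_))
  simp [cut, Set.indicator]; split_ifs <;> simp

theorem truncFourier_smul (c : ℂ) (f : L2 p) (N : ℕ) :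
    truncFourier (c • f) N = c • truncFourier f N := by
  rw [truncFourier, truncFourier, ← MemLp.toLp_const_smul]
  congr 1
  rw [← fourierIntegral_smul]
  refine fourierIntegral_congr_ae ((cut_ae_eq (Lp.coeFn_smul c f) N).trans (.of_forall fun x => ?_))
  simp [cut, Set.indicator]

theorem norm_truncFourier_le (f : L2 p) (N : ℕ) : ‖truncFourier f N‖ ≤ ‖f‖ := by
  rw [truncFourier, Lp.norm_toLp, Lp.norm_def]
  refine ENNReal.toReal_mono (Lp.memLp f).2.ne
    ((eLpNorm_fourierIntegral_le (integrable_cut f N)).trans ?_)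
  exact eLpNorm_indicator_le f

/-- The Fourier transform as a continuous linear map. -/
noncomputable def fourierCLM (p : ℕ) [Fact p.Prime] : L2 p →L[ℂ] L2 p :=
  LinearMap.mkContinuous
    { toFun := fourierL2
      map_add' := fun f g => tendsto_nhds_unique (tendsto_truncFourier (f + g))
        (((tendsto_truncFourier f).add (tendsto_truncFourier g)).congr
          fun N => (truncFourier_add f g N).symm)
      map_smul' := fun c f => tendsto_nhds_unique (tendsto_truncFourier (c • f))
        (((tendsto_truncFourier f).const_smul c).congr
          fun N => (truncFourier_smul c f N).symm) } 1 fun f => by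
    rw [one_mul]
    exact le_of_tendsto (tendsto_truncFourier f).norm
      (.of_forall fun N => norm_truncFourier_le f N)

theorem fourierCLM_apply (f : L2 p) : fourierCLM p f = fourierL2 f := rfl

/-- The integral of an integrable function over a ball in terms of its Fourier integral. -/
theorem setIntegral_fourierIntegral {f : ℚ_[p] → ℂ} (hf : Integrable f (haar p)) (M : ℤ)
    (x₀ : ℚ_[p]) :
    ∫ ξ in closedBall 0 ((p : ℝ) ^ M), chi (-(ξ * x₀)) * fourierIntegral f ξ ∂(haar p) =
      (haar p).real (closedBall 0 ((p : ℝ) ^ M)) *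
        ∫ x in closedBall x₀ ((p : ℝ) ^ (-M)), f x ∂(haar p) := by
  have hc := continuous_chi p
  have : IsFiniteMeasure ((haar p).restrict (closedBall 0 ((p : ℝ) ^ M))) :=
    ⟨by simpa using (haar_closedBall_ne_top 0 _).lt_top⟩
  have hint : Integrable (Function.uncurry fun (ξ x : ℚ_[p]) => chi (ξ * (x - x₀)) * f x)
      (((haar p).restrict (closedBall 0 ((p : ℝ) ^ M))).prod (haar p)) := by
    refine (hf.comp_snd _).bdd_mul (c := 1) ?_ (.of_forall fun z => by simp)
    exact (hc.comp (by fun_prop)).aestronglyMeasurable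
  have h1 : ∀ ξ, chi (-(ξ * x₀)) * fourierIntegral f ξ =
      ∫ x, chi (ξ * (x - x₀)) * f x ∂(haar p) := by
    intro ξ
    rw [fourierIntegral, ← integral_const_mul]
    congr 1; ext x
    rw [← mul_assoc, ← chi_add]; congr 2; ring
  simp_rw [h1]
  -- After Fubini the inner integral over `ξ` is a multiple of the indicator of the ball dual to
  -- `B_M`, centred at `x₀`.
  rw [integral_integral_swap hint]
  simp_rw [integral_mul_const, setIntegral_chi]
  rw [← integral_const_mul, ← integral_indicator isClosed_closedBall.measurableSet]
  congr 1; ext x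
  by_cases hx : x ∈ closedBall x₀ ((p : ℝ) ^ (-M))
  · rw [Set.indicator_of_mem hx, Set.indicator_of_mem]
    simpa [dist_eq_norm] using hx
  · rw [Set.indicator_of_notMem hx, Set.indicator_of_notMem, zero_mul]
    simpa [dist_eq_norm] using hx

theorem memLp_indicator_chi (M : ℤ) (x₀ : ℚ_[p]) :
    MemLp ((closedBall (0 : ℚ_[p]) ((p : ℝ) ^ M)).indicator fun ξ => chi (ξ * x₀)) 2 (haar p) := by
  refine (memLp_indicator_iff_restrict isClosed_closedBall.measurableSet).2 ?_
  have : IsFiniteMeasure ((haar p).restrict (closedBall 0 ((p : ℝ) ^ M))) :=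
    ⟨by simpa using (haar_closedBall_ne_top 0 _).lt_top⟩
  exact MemLp.of_bound ((continuous_chi p).comp (by fun_prop)).aestronglyMeasurable 1
    (.of_forall fun x => by simp)

/-- A local form of Fourier inversion. Both sides are inner products with fixed `L²` vectors, hence
continuous, so the identity passes from the truncations of `f` to the limit. -/
theorem setIntegral_fourierL2 (f : L2 p) (M : ℤ) (x₀ : ℚ_[p]) :
    ∫ ξ in closedBall 0 ((p : ℝ) ^ M), chi (-(ξ * x₀)) * fourierL2 f ξ ∂(haar p) =
      (haar p).real (closedBall 0 ((p : ℝ) ^ M)) *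
        ∫ x in closedBall x₀ ((p : ℝ) ^ (-M)), f x ∂(haar p) := by
  set e : L2 p := (memLp_indicator_chi M x₀).toLp with he
  have hinner : ∀ g : L2 p, inner ℂ e g =
      ∫ ξ in closedBall 0 ((p : ℝ) ^ M), chi (-(ξ * x₀)) * g ξ ∂(haar p) := by
    intro g
    rw [L2.inner_def, ← integral_indicator isClosed_closedBall.measurableSet]
    refine integral_congr_ae ((MemLp.coeFn_toLp (memLp_indicator_chi M x₀)).mono fun ξ hξ => ?_)
    simp only [he, hξ]
    by_cases h : ξ ∈ closedBall (0 : ℚ_[p]) ((p : ℝ) ^ M)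
    · simp only [Set.indicator_of_mem h, chi_neg, RCLike.inner_apply]; ring
    · simp [Set.indicator_of_notMem h]
  rw [← hinner, ← inner_ballInd]
  have h1 : Tendsto (fun N => inner ℂ e (truncFourier f N)) atTop (𝓝 (inner ℂ e (fourierL2 f))) :=
    tendsto_const_nhds.inner (tendsto_truncFourier f)
  have h2 : Tendsto (fun N => ((haar p).real (closedBall 0 ((p : ℝ) ^ M)) : ℂ) *
      inner ℂ (ballInd x₀ ((p : ℝ) ^ (-M))) ((memLp_cut f N).toLp)) atTop
      (𝓝 (((haar p).real (closedBall 0 ((p : ℝ) ^ M)) : ℂ) *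
        inner ℂ (ballInd x₀ ((p : ℝ) ^ (-M))) f)) :=
    (tendsto_const_nhds.inner (tendsto_cut f)).const_mul _
  refine tendsto_nhds_unique h1 (h2.congr fun N => ?_)
  rw [hinner, inner_ballInd,
    integral_congr_ae (ae_restrict_of_ae (MemLp.coeFn_toLp (memLp_cut f N))),
    ← setIntegral_fourierIntegral (integrable_cut f N)]
  exact integral_congr_ae (ae_restrict_of_ae ((truncFourier_coeFn f N).mono fun ξ hξ => by
    simp [hξ]))

theorem haar_closedBall_center (x : ℚ_[p]) (r : ℝ) :
    haar p (closedBall x r) = haar p (closedBall 0 r) := by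
  rw [← measure_preimage_add_right (haar p) (-x) (closedBall 0 r)]
  congr 1; ext y; simp [dist_eq_norm, sub_eq_add_neg]

theorem haar_real_closedBall_one (x : ℚ_[p]) : (haar p).real (closedBall x 1) = 1 := by
  rw [Measure.real, haar_closedBall_center, haar_closedBall_zero_one, ENNReal.toReal_one]

/-- Each point off the support has a neighbourhood on which `f` vanishes almost everywhere, and a
locally null set is null because `ℚ_p` is second countable. -/
theorem ae_eq_zero_of_notMem_essSupport (f : ℚ_[p] → ℂ) :
    ∀ᵐ x ∂(haar p), x ∉ essSupport f → f x = 0 := by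
  refine measure_null_of_locally_null _ fun x hx => ?_
  have hx' : x ∉ essSupport f ∧ f x ≠ 0 := by simpa using hx
  obtain ⟨U, hU, h⟩ : ∃ U ∈ 𝓝 x, haar p {y ∈ U | f y ≠ 0} = 0 := by
    simpa [essSupport] using hx'.1
  refine ⟨U ∩ {x | x ∉ essSupport f → f x = 0}ᶜ,
    inter_mem (mem_nhdsWithin_of_mem_nhds hU) self_mem_nhdsWithin, ?_⟩
  refine measure_mono_null ?_ h
  rintro y ⟨hy, hy'⟩
  have hy' : y ∉ essSupport f ∧ f y ≠ 0 := by simpa using hy'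
  exact ⟨hy, hy'.2⟩

/-- A function whose Fourier transform is supported in the unit ball is invariant under shifts by
elements of the unit ball. -/
theorem exists_invariant_representative (φ : L2 p)
    (hsupp : essSupport (fourierL2 φ) ⊆ closedBall 0 1) :
    ∃ c : ℚ_[p] → ℂ, φ =ᵐ[haar p] c ∧ ∀ x h, ‖h‖ ≤ 1 → c (x + h) = c x := by
  -- The inverse Fourier integral, which needs only the unit ball because the transform vanishes
  -- almost everywhere outside it.
  set c : ℚ_[p] → ℂ := fun x =>
    ∫ ξ in closedBall 0 1, chi (-(ξ * x)) * fourierL2 φ ξ ∂(haar p) with hc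
  have hinv : ∀ x h, ‖h‖ ≤ 1 → c (x + h) = c x := by
    intro x h hh
    refine setIntegral_congr_fun isClosed_closedBall.measurableSet fun ξ hξ => ?_
    have hξ' : ‖ξ‖ ≤ 1 := by simpa using hξ
    have h1 : chi (-(ξ * h)) = 1 := chi_eq_one (by
      rw [norm_neg, norm_mul]; exact mul_le_one₀ hξ' (norm_nonneg _) hh)
    rw [mul_add, neg_add, chi_add, h1, mul_one]
  have hconst : ∀ (x : ℚ_[p]) (r : ℝ), r ≤ 1 → ∀ y ∈ closedBall x r, c y = c x := by
    intro x r hr y hy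
    rw [← hinv x (y - x) (by rw [← dist_eq_norm]; exact (mem_closedBall.1 hy).trans hr)]
    congr 1; ring
  have hcint : ∀ (x : ℚ_[p]) (r : ℝ), r ≤ 1 → IntegrableOn c (closedBall x r) (haar p) := by
    intro x r hr
    refine (integrableOn_congr_fun (hconst x r hr) isClosed_closedBall.measurableSet).2 ?_
    exact integrableOn_const (haar_closedBall_ne_top x r)
  have hdiff : (fun x => φ x - c x) =ᵐ[haar p] 0 := by
    refine ae_eq_zero_of_forall_setIntegral_closedBall
      (fun x => (integrableOn_closedBall φ x 1).sub (hcint x 1 le_rfl)) fun x n => ?_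
    have hr : (p : ℝ) ^ (-(n : ℤ)) ≤ 1 := zpow_le_one_of_nonpos₀ (one_lt_p p).le (by simp)
    have hr' : 1 ≤ (p : ℝ) ^ (n : ℤ) := one_le_zpow₀ (one_lt_p p).le (by simp)
    rw [integral_sub (integrableOn_closedBall φ x _) (hcint x _ hr), sub_eq_zero,
      setIntegral_congr_fun isClosed_closedBall.measurableSet (hconst x _ hr), setIntegral_const]
    have h1 := setIntegral_fourierL2 φ n x
    -- Enlarging the domain of integration beyond the unit ball changes nothing, so local inversion
    -- at every scale `n` gives `c x` as the mean of `φ` over the ball of radius `p ^ (-n)`.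
    have h2 : ∫ ξ in closedBall 0 ((p : ℝ) ^ (n : ℤ)), chi (-(ξ * x)) * fourierL2 φ ξ ∂(haar p)
        = c x := by
      refine setIntegral_eq_of_subset_of_ae_sdiff_eq_zero
        isClosed_closedBall.measurableSet.nullMeasurableSet (closedBall_subset_closedBall hr') ?_
      filter_upwards [ae_eq_zero_of_notMem_essSupport (fourierL2 φ)] with ξ hξ hξ'
      rw [hξ fun h => hξ'.2 (hsupp h), mul_zero]
    rw [h2] at h1
    have h3 : (haar p).real (closedBall x ((p : ℝ) ^ (-(n : ℤ)))) *
        (haar p).real (closedBall 0 ((p : ℝ) ^ (n : ℤ))) = 1 := by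
      rw [Measure.real, Measure.real, ← ENNReal.toReal_mul, haar_closedBall_center, mul_comm,
        haar_closedBall_mul, ENNReal.toReal_one]
    rw [h1, Complex.real_smul, ← mul_assoc, ← Complex.ofReal_mul, h3, Complex.ofReal_one, one_mul]
  exact ⟨c, hdiff.mono fun x hx => sub_eq_zero.1 hx, hinv⟩

/-! ### The shifts as representatives of `ℚ_p / ℤ_p` -/

theorem sum_digits_lt {q : ℕ} {d : ℕ → ℕ} (hd : ∀ i, d i < q) (n : ℕ) :
    ∑ i ∈ Finset.range n, d i * q ^ i < q ^ n := by
  induction n with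
  | zero => simp
  | succ n ih =>
    rw [Finset.sum_range_succ, pow_succ]
    have := Nat.mul_le_mul_right (q ^ n) (Nat.succ_le_of_lt (hd n))
    rw [Nat.succ_mul] at this
    linarith [mul_comm q (q ^ n)]

theorem sum_digits_eq_mod (q m n : ℕ) :
    ∑ i ∈ Finset.range n, (m / q ^ i % q) * q ^ i = m % q ^ n := by
  induction n with
  | zero => simp [Nat.mod_one]
  | succ n ih => rw [Finset.sum_range_succ, ih, Nat.mod_pow_succ, mul_comm]

theorem mem_shifts_iff {a : ℚ_[p]} :
    a ∈ shifts p ↔ ∃ n m : ℕ, m < p ^ n ∧ a = (((m : ℚ) / (p : ℚ) ^ n : ℚ) : ℚ_[p]) := by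
  constructor
  · rintro ⟨n, -, d, hd, rfl⟩
    refine ⟨n, _, sum_digits_lt hd n, ?_⟩
    push_cast
    rw [zpow_neg, zpow_natCast, div_eq_inv_mul]
  · have hpos : 0 < p := (Fact.out : p.Prime).pos
    have hp := p_ne_zero p
    rintro ⟨n, m, hm, rfl⟩
    -- The definition of `shifts` demands `γ ≥ 1`; rewriting `m / p ^ n` as `m * p / p ^ (n + 1)`
    -- covers `n = 0` as well.
    have hm' : m * p < p ^ (n + 1) := by rw [pow_succ]; exact Nat.mul_lt_mul_of_pos_right hm hpos
    refine ⟨n + 1, by simp, fun i => m * p / p ^ i % p, fun i => Nat.mod_lt _ hpos, ?_⟩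
    have h := sum_digits_eq_mod p (m * p) (n + 1)
    rw [Nat.mod_eq_of_lt hm'] at h
    have h' : ∑ i ∈ Finset.range (n + 1), ((m * p / p ^ i % p : ℕ) : ℚ_[p]) * (p : ℚ_[p]) ^ i =
        (m : ℚ_[p]) * p := by exact_mod_cast congrArg (Nat.cast : ℕ → ℚ_[p]) h
    rw [h', zpow_neg, zpow_natCast]
    push_cast
    field_simp
    ring

instance countable_shifts (p : ℕ) [Fact p.Prime] : Countable (shifts p) := by
  have : shifts p ⊆ Set.range ((↑) : ℚ → ℚ_[p]) := by
    intro a ha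
    obtain ⟨n, m, -, rfl⟩ := mem_shifts_iff.1 ha
    exact ⟨_, rfl⟩
  exact ((Set.countable_range _).mono this).to_subtype

theorem zero_mem_shifts : (0 : ℚ_[p]) ∈ shifts p := mem_shifts_iff.2 ⟨0, 0, by simp, by simp⟩

theorem exists_mem_shifts (x : ℚ_[p]) : ∃ a : shifts p, x ∈ closedBall (a : ℚ_[p]) 1 := by
  obtain ⟨q, ⟨n, m, hm, hq⟩, h⟩ := exists_fract p x
  exact ⟨⟨q, mem_shifts_iff.2 ⟨n, m, hm, by rw [hq]⟩⟩, by simpa [dist_eq_norm] using h⟩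

/-- Both are rationals in `[0, 1)` with `p`-power denominators; a difference that is a `p`-adic
integer is then an ordinary integer in `(-1, 1)`. -/
theorem shifts_eq_of_norm_sub_le {a b : ℚ_[p]} (ha : a ∈ shifts p) (hb : b ∈ shifts p)
    (h : ‖a - b‖ ≤ 1) : a = b := by
  obtain ⟨n, m, hm, rfl⟩ := mem_shifts_iff.1 ha
  obtain ⟨n', m', hm', rfl⟩ := mem_shifts_iff.1 hb
  have hpos : (0 : ℚ) < p := Nat.cast_pos.2 (Fact.out : p.Prime).pos
  have e : (m : ℚ) / (p : ℚ) ^ n - (m' : ℚ) / (p : ℚ) ^ n' =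
      ((m * p ^ n' - m' * p ^ n : ℤ) : ℚ) / (p : ℚ) ^ (n + n') := by
    push_cast; rw [pow_add]; field_simp
  rw [← Rat.cast_sub, e] at h
  obtain ⟨k, hk⟩ := eq_intCast_of_norm_le_one h
  rw [← e] at hk
  have h1 : (m : ℚ) / (p : ℚ) ^ n < 1 := (div_lt_one (by positivity)).2 (by exact_mod_cast hm)
  have h2 : (m' : ℚ) / (p : ℚ) ^ n' < 1 := (div_lt_one (by positivity)).2 (by exact_mod_cast hm')
  have h3 : 0 ≤ (m : ℚ) / (p : ℚ) ^ n := by positivity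
  have h4 : 0 ≤ (m' : ℚ) / (p : ℚ) ^ n' := by positivity
  have h5 : k < 1 := by exact_mod_cast (by linarith : (k : ℚ) < 1)
  have h6 : -1 < k := by exact_mod_cast (by linarith : (-1 : ℚ) < k)
  have h7 : k = 0 := by omega
  rw [h7, Int.cast_zero, sub_eq_zero] at hk
  rw [hk]

/-- The unit balls centred at the shifts partition `ℚ_p`, since `I_p` is a set of representatives of
`ℚ_p / ℤ_p`. -/
theorem hasSum_setIntegral_shifts {E : Type*} [NormedAddCommGroup E] [NormedSpace ℝ E]
    {f : ℚ_[p] → E} (hf : Integrable f (haar p)) :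
    HasSum (fun a : shifts p => ∫ x in closedBall (a : ℚ_[p]) 1, f x ∂(haar p))
      (∫ x, f x ∂(haar p)) := by
  have hU : (⋃ a : shifts p, closedBall (a : ℚ_[p]) 1) = Set.univ :=
    Set.eq_univ_of_forall fun x => Set.mem_iUnion.2 (exists_mem_shifts x)
  rw [← setIntegral_univ, ← hU]
  refine hasSum_integral_iUnion (fun a => isClosed_closedBall.measurableSet) ?_ hf.integrableOn
  intro a b hab
  rcases IsUltrametricDist.closedBall_eq_or_disjoint (a : ℚ_[p]) (b : ℚ_[p]) 1 with h | h
  · have : (a : ℚ_[p]) ∈ closedBall (b : ℚ_[p]) 1 := h ▸ mem_closedBall_self zero_le_one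
    exact absurd (Subtype.ext (shifts_eq_of_norm_sub_le a.2 b.2 (by simpa [dist_eq_norm] using this)))
      hab
  · exact h

/-! ### Dilations -/

/-- Uniqueness of Haar measure. Only finiteness of the constant matters later, for null sets and for
boundedness of dilations. -/
theorem map_smul_haar (j : ℤ) : ∃ C : ENNReal, C ≠ ∞ ∧
    (haar p).map (fun x => (p : ℚ_[p]) ^ j * x) = C • haar p := by
  set u : ℚ_[p]ˣ := (Units.mk0 (p : ℚ_[p]) (p_ne_zero p)) ^ j with hu
  have e : (fun x => (p : ℚ_[p]) ^ j * x) = fun x => u • x := by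
    ext x; simp [hu, Units.smul_def]
  have : ((haar p).map fun x => u • x).IsAddHaarMeasure :=
    (DistribMulAction.toAddEquiv ℚ_[p] u).isAddHaarMeasure_map (haar p)
      (continuous_const_smul u) (continuous_const_smul u⁻¹)
  rw [e, Measure.isAddLeftInvariant_eq_smul ((haar p).map fun x => u • x) (haar p)]
  exact ⟨_, ENNReal.coe_ne_top, rfl⟩

theorem quasiMeasurePreserving_mul (j : ℤ) :
    Measure.QuasiMeasurePreserving (fun x => (p : ℚ_[p]) ^ j * x) (haar p) (haar p) := by
  refine ⟨(continuous_const_mul _).measurable, ?_⟩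
  obtain ⟨C, -, h⟩ := map_smul_haar (p := p) j
  rw [h]
  exact Measure.smul_absolutelyContinuous

theorem quasiMeasurePreserving_mul_sub (j : ℤ) (a : ℚ_[p]) :
    Measure.QuasiMeasurePreserving (fun x => (p : ℚ_[p]) ^ j * x - a) (haar p) (haar p) :=
  (measurePreserving_sub_right (haar p) a).quasiMeasurePreserving.comp (quasiMeasurePreserving_mul j)

theorem atom_coeFn {f : L2 p} {c : ℚ_[p] → ℂ} (h : f =ᵐ[haar p] c) (j : ℤ) (a : ℚ_[p]) :
    atom f j a =ᵐ[haar p] fun x => c ((p : ℚ_[p]) ^ (-j) * x - a) :=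
  (MemLp.coeFn_toLp (memLp_atom f j a)).trans
    ((quasiMeasurePreserving_mul_sub (-j) a).ae_eq_comp h)

theorem atom_atom (f : L2 p) (i j : ℤ) (a b : ℚ_[p]) :
    atom (atom f i a) j b = atom f (i + j) ((p : ℚ_[p]) ^ (-i) * b + a) := by
  refine Lp.ext ((atom_coeFn (atom_coeFn EventuallyEq.rfl i a) j b).trans
    (.trans ?_ (atom_coeFn EventuallyEq.rfl _ _).symm))
  refine .of_forall fun x => ?_
  simp only
  congr 1
  rw [neg_add, zpow_add₀ (p_ne_zero p)]
  ring

theorem atom_zero_zero (f : L2 p) : atom f 0 0 = f :=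
  Lp.ext ((atom_coeFn EventuallyEq.rfl 0 0).trans (.of_forall fun x => by simp))

theorem exists_norm_atom_le (p : ℕ) [Fact p.Prime] (j : ℤ) :
    ∃ C : ℝ, ∀ f : L2 p, ‖atom f j 0‖ ≤ C * ‖f‖ := by
  obtain ⟨C, hC, h⟩ := map_smul_haar (p := p) (-j)
  refine ⟨(C ^ (1 / 2 : ℝ)).toReal, fun f => ?_⟩
  rw [atom, Lp.norm_toLp, Lp.norm_def, ← ENNReal.toReal_mul]
  have hm : Measurable fun x => (p : ℚ_[p]) ^ (-j) * x := (continuous_const_mul _).measurable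
  have hs : AEStronglyMeasurable f ((haar p).map fun x => (p : ℚ_[p]) ^ (-j) * x) := by
    rw [h]; exact (Lp.memLp f).1.smul_measure C
  have e := eLpNorm_map_measure (p := 2) hs hm.aemeasurable
  rw [h, eLpNorm_smul_measure_of_ne_top (by simp)] at e
  simp only [sub_zero]
  change (eLpNorm (f ∘ fun x => (p : ℚ_[p]) ^ (-j) * x) 2 (haar p)).toReal ≤ _
  rw [← e]
  simp

/-- The dilation `f ↦ f(p ^ (-j) ·)` as a continuous linear map. -/
noncomputable def dilation (p : ℕ) [Fact p.Prime] (j : ℤ) : L2 p →L[ℂ] L2 p :=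
  LinearMap.mkContinuousOfExistsBound
    { toFun := fun f => atom f j 0
      map_add' := fun f g => by
        refine Lp.ext ((atom_coeFn (Lp.coeFn_add f g) j 0).trans (.trans ?_ (Lp.coeFn_add _ _).symm))
        filter_upwards [atom_coeFn (EventuallyEq.rfl (f := f)) j 0,
          atom_coeFn (EventuallyEq.rfl (f := g)) j 0] with x h1 h2
        simp [h1, h2]
      map_smul' := fun c f => by
        refine Lp.ext ((atom_coeFn (Lp.coeFn_smul c f) j 0).trans
          (.trans ?_ (Lp.coeFn_smul _ _).symm))
        filter_upwards [atom_coeFn (EventuallyEq.rfl (f := f)) j 0] with x h1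
        simp [h1] } (exists_norm_atom_le p j)

theorem dilation_apply (j : ℤ) (f : L2 p) : dilation p j f = atom f j 0 := rfl

theorem dilation_mem_V {φ f : L2 p} (hf : f ∈ V φ 0) (j : ℤ) : dilation p j f ∈ V φ j := by
  refine map_mem_closure (dilation p j).continuous hf fun g hg => ?_
  induction hg using Submodule.span_induction with
  | mem x hx =>
    obtain ⟨a, rfl⟩ := hx
    refine Submodule.subset_span ⟨a, ?_⟩
    simp [dilation_apply, atom_atom]
  | zero => rw [map_zero]; exact Submodule.zero_mem _
  | add x y _ _ hx hy => rw [map_add]; exact Submodule.add_mem _ hx hy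
  | smul c x _ hx => rw [map_smul]; exact Submodule.smul_mem _ c hx

/-! ### Equality in Bessel's inequality and the indicators in `V_0` -/

/-- The squared distance from `x` to its partial expansion is `‖x‖ ^ 2` minus the partial sum of
squared coefficients, so equality in Bessel's inequality makes the expansion converge to `x`. -/
theorem _root_.Orthonormal.mem_topologicalClosure_span_of_hasSum {ι E : Type*}
    [NormedAddCommGroup E] [InnerProductSpace ℂ E] {v : ι → E} (hv : Orthonormal ℂ v) {x : E}
    (h : HasSum (fun i => ‖inner ℂ (v i) x‖ ^ 2) (‖x‖ ^ 2)) :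
    x ∈ (Submodule.span ℂ (Set.range v)).topologicalClosure := by
  have key : ∀ s : Finset ι, ‖x - ∑ i ∈ s, inner ℂ (v i) x • v i‖ ^ 2 =
      ‖x‖ ^ 2 - ∑ i ∈ s, ‖inner ℂ (v i) x‖ ^ 2 := by
    intro s
    set y := ∑ i ∈ s, inner ℂ (v i) x • v i with hy
    have h1 : inner ℂ x y = ((∑ i ∈ s, ‖inner ℂ (v i) x‖ ^ 2 : ℝ) : ℂ) := by
      rw [hy, inner_sum, Complex.ofReal_sum]
      refine Finset.sum_congr rfl fun i _ => ?_
      rw [inner_smul_right, ← inner_conj_symm x (v i), Complex.mul_conj, Complex.normSq_eq_norm_sq]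
    have h2 : inner ℂ y y = ((∑ i ∈ s, ‖inner ℂ (v i) x‖ ^ 2 : ℝ) : ℂ) := by
      rw [hy, hv.inner_sum, Complex.ofReal_sum]
      refine Finset.sum_congr rfl fun i _ => ?_
      rw [mul_comm, Complex.mul_conj, Complex.normSq_eq_norm_sq]
    have h3 : ‖y‖ ^ 2 = ∑ i ∈ s, ‖inner ℂ (v i) x‖ ^ 2 := by
      rw [← inner_self_eq_norm_sq (𝕜 := ℂ), h2, RCLike.re_to_complex, Complex.ofReal_re]
    rw [norm_sub_sq (𝕜 := ℂ), h1, h3]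
    simp only [RCLike.re_to_complex, Complex.ofReal_re]
    ring
  refine mem_closure_of_tendsto (f := fun s : Finset ι => ∑ i ∈ s, inner ℂ (v i) x • v i)
    (b := atTop) ?_ (.of_forall fun s => ?_)
  · rw [tendsto_iff_norm_sub_tendsto_zero]
    have h1 : Tendsto (fun s : Finset ι => ‖x - ∑ i ∈ s, inner ℂ (v i) x • v i‖ ^ 2) atTop (𝓝 0) := by
      simp_rw [key]
      have h' := (tendsto_const_nhds (x := ‖x‖ ^ 2)).sub h
      rwa [sub_self] at h'
    have h2 := h1.sqrt
    simpa [Real.sqrt_sq, norm_sub_rev] using h2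
  · exact Submodule.sum_mem _ fun i _ =>
      Submodule.smul_mem _ _ (Submodule.subset_span ⟨i, rfl⟩)

theorem norm_sq_eq_integral (f : L2 p) : ‖f‖ ^ 2 = ∫ x, ‖f x‖ ^ 2 ∂(haar p) := by
  have h : inner ℂ f f = ((∫ x, ‖f x‖ ^ 2 ∂(haar p) : ℝ) : ℂ) := by
    rw [L2.inner_def, ← integral_complex_ofReal]
    congr 1; ext x
    rw [inner_self_eq_norm_sq_to_K]; simp
  rw [← inner_self_eq_norm_sq (𝕜 := ℂ), h]; simp

theorem norm_sq_eq_integral_of_ae_eq {f : L2 p} {c : ℚ_[p] → ℂ} (h : f =ᵐ[haar p] c) :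
    ‖f‖ ^ 2 = ∫ x, ‖c x‖ ^ 2 ∂(haar p) := by
  rw [norm_sq_eq_integral]
  exact integral_congr_ae (h.mono fun x hx => by simp [hx])

theorem norm_ballInd_one (b : ℚ_[p]) : ‖ballInd b 1‖ = 1 := by
  have h : inner ℂ (ballInd b 1) (ballInd b 1) = 1 := by
    rw [inner_ballInd, integral_congr_ae (ae_restrict_of_ae (ballInd_coeFn b 1)),
      setIntegral_congr_fun (g := fun _ => (1 : ℂ)) isClosed_closedBall.measurableSet
        fun x hx => by simp [Set.indicator_of_mem hx]]
    simp [haar_real_closedBall_one]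
  have h2 : ‖ballInd b 1‖ ^ 2 = 1 := by
    rw [← inner_self_eq_norm_sq (𝕜 := ℂ), h]; simp
  exact (pow_eq_one_iff_of_nonneg (norm_nonneg _) two_ne_zero).1 h2

theorem eq_of_mem_closedBall {c : ℚ_[p] → ℂ} {r : ℝ} (hinv : ∀ x h, ‖h‖ ≤ r → c (x + h) = c x)
    {x y : ℚ_[p]} (hy : y ∈ closedBall x r) : c y = c x := by
  rw [← hinv x (y - x) (by rwa [← dist_eq_norm, ← mem_closedBall])]
  congr 1; ring

/-- If `φ` is invariant under shifts by elements of the unit ball, and its shifts are orthonormal,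
then `V_0` contains the indicator functions of all balls of radius `1`. -/
theorem ballInd_one_mem_V {φ : L2 p} {c : ℚ_[p] → ℂ} (hφ : φ =ᵐ[haar p] c)
    (hinv : ∀ x h, ‖h‖ ≤ 1 → c (x + h) = c x)
    (horth : Orthonormal ℂ (fun a : shifts p => atom φ 0 (a : ℚ_[p]))) (b : ℚ_[p]) :
    ballInd b 1 ∈ V φ 0 := by
  have hatom : ∀ a : ℚ_[p], atom φ 0 a =ᵐ[haar p] fun x => c (x - a) := fun a =>
    (atom_coeFn hφ 0 a).trans (.of_forall fun x => by simp)
  have hc1 : ∫ x, ‖c x‖ ^ 2 ∂(haar p) = 1 := by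
    have h := norm_sq_eq_integral_of_ae_eq (hatom 0)
    have h1 : ‖atom φ 0 0‖ = 1 := horth.1 ⟨0, zero_mem_shifts⟩
    simpa [h1] using h.symm
  -- The shifted function equals the constant `c (b - a)` on the ball around `b`, whose measure is
  -- `1`.
  have hcoef : ∀ a : ℚ_[p], ‖inner ℂ (atom φ 0 a) (ballInd b 1)‖ = ‖c (b - a)‖ := by
    intro a
    rw [norm_inner_symm, inner_ballInd, integral_congr_ae (ae_restrict_of_ae (hatom a)),
      setIntegral_congr_fun (g := fun _ => c (b - a)) isClosed_closedBall.measurableSet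
        fun x hx => eq_of_mem_closedBall hinv (by simpa using hx),
      setIntegral_const, haar_real_closedBall_one, one_smul]
  refine horth.mem_topologicalClosure_span_of_hasSum ?_
  simp_rw [hcoef, norm_ballInd_one, one_pow]
  have hint : Integrable (fun x => ‖c (b - x)‖ ^ 2) (haar p) := by
    have : Integrable (fun x => ‖c x‖ ^ 2) (haar p) := by
      by_contra h
      rw [integral_undef h] at hc1
      exact zero_ne_one hc1
    exact this.comp_sub_left b
  -- The reflected function `x ↦ ‖c (b - x)‖ ^ 2` is constant on unit balls, so its integral, which
  -- is `1`, equals the sum of its values at the shifts.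
  have h := hasSum_setIntegral_shifts hint
  rw [integral_sub_left_eq_self (fun x => ‖c x‖ ^ 2) (haar p) b, hc1] at h
  have hval : ∀ a : shifts p,
      ∫ x in closedBall (a : ℚ_[p]) 1, ‖c (b - x)‖ ^ 2 ∂(haar p) = ‖c (b - a)‖ ^ 2 := by
    intro a
    rw [setIntegral_congr_fun (g := fun _ => ‖c (b - a)‖ ^ 2) isClosed_closedBall.measurableSet
      fun x hx => by
        have : b - x ∈ closedBall (b - (a : ℚ_[p])) 1 := by
          rwa [mem_closedBall, dist_sub_left]
        simp [eq_of_mem_closedBall hinv this]]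
    simp [haar_real_closedBall_one]
  simp_rw [hval] at h
  exact h

/-! ### Periodic functions and density of the union of the `V_j` -/

/-- The subspace of functions in `L²(ℚ_p)` that are invariant under all shifts of norm at
most `r`. -/
def invariantSubspace (p : ℕ) [Fact p.Prime] (r : ℝ) : Submodule ℂ (L2 p) where
  carrier := {f | ∃ c : ℚ_[p] → ℂ, f =ᵐ[haar p] c ∧ ∀ x h, ‖h‖ ≤ r → c (x + h) = c x}
  add_mem' := by
    rintro f g ⟨c, hf, hc⟩ ⟨d, hg, hd⟩
    exact ⟨c + d, (Lp.coeFn_add f g).trans (hf.add hg), fun x h hh => by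
      simp [hc x h hh, hd x h hh]⟩
  zero_mem' := ⟨0, Lp.coeFn_zero _ _ _, fun _ _ _ => rfl⟩
  smul_mem' := by
    rintro k f ⟨c, hf, hc⟩
    exact ⟨k • c, (Lp.coeFn_smul k f).trans (hf.const_smul k), fun x h hh => by
      simp [hc x h hh]⟩

theorem invariantSubspace_anti {r s : ℝ} (h : r ≤ s) :
    invariantSubspace p s ≤ invariantSubspace p r := by
  rintro f ⟨c, hf, hc⟩
  exact ⟨c, hf, fun x y hy => hc x y (hy.trans h)⟩

theorem ballInd_mem_invariantSubspace (x : ℚ_[p]) (r : ℝ) :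
    ballInd x r ∈ invariantSubspace p r := by
  refine ⟨_, ballInd_coeFn x r, fun y h hh => ?_⟩
  have : y + h ∈ closedBall x r ↔ y ∈ closedBall x r := by
    rw [mem_closedBall, mem_closedBall, dist_eq_norm, dist_eq_norm]
    constructor
    · intro h1
      rw [show y - x = (y + h - x) + -h by ring]
      exact (IsUltrametricDist.norm_add_le_max _ _).trans (max_le h1 (by rwa [norm_neg]))
    · intro h1
      rw [show y + h - x = (y - x) + h by ring]
      exact (IsUltrametricDist.norm_add_le_max _ _).trans (max_le h1 hh)
  by_cases hy : y ∈ closedBall x r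
  · rw [Set.indicator_of_mem hy, Set.indicator_of_mem (this.2 hy)]; rfl
  · rw [Set.indicator_of_notMem hy, Set.indicator_of_notMem fun h' => hy (this.1 h')]

/-- The union is directed, so density reduces to a trivial orthogonal complement; a function
orthogonal to the indicators of all small balls is zero. -/
theorem closure_iUnion_invariantSubspace (p : ℕ) [Fact p.Prime] :
    closure (⋃ n : ℕ, (invariantSubspace p ((p : ℝ) ^ (-(n : ℤ))) : Set (L2 p))) = Set.univ := by
  have hdir : Directed (· ≤ ·) fun n : ℕ => invariantSubspace p ((p : ℝ) ^ (-(n : ℤ))) :=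
    Monotone.directed_le <| monotone_nat_of_le_succ fun n => invariantSubspace_anti
      (zpow_le_zpow_right₀ (one_lt_p p).le (by simp))
  rw [← Submodule.coe_iSup_of_directed _ hdir, ← Submodule.topologicalClosure_coe,
    Submodule.topologicalClosure_eq_top_iff.2, Submodule.top_coe]
  rw [Submodule.eq_bot_iff]
  intro g hg
  rw [Lp.eq_zero_iff_ae_eq_zero]
  refine ae_eq_zero_of_forall_setIntegral_closedBall (fun x => integrableOn_closedBall g x 1)
    fun x n => ?_
  rw [← inner_ballInd]
  exact hg _ (Submodule.mem_iSup_of_mem n (ballInd_mem_invariantSubspace x _))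

theorem invariantSubspace_one_le_V {φ : L2 p} (h : ∀ b : ℚ_[p], ballInd b 1 ∈ V φ 0) :
    invariantSubspace p 1 ≤ V φ 0 := by
  rintro f ⟨c, hf, hc⟩
  -- As `V_0` is closed, it suffices to test `f` against `g` orthogonal to `V_0`. On each unit ball
  -- `f` is constant and `g` has integral zero, so the inner product vanishes ball by ball.
  have hV : V φ 0 = (V φ 0)ᗮᗮ := by
    rw [Submodule.orthogonal_orthogonal_eq_closure]
    exact (IsClosed.submodule_topologicalClosure_eq
      (Submodule.isClosed_topologicalClosure _)).symm
  rw [hV]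
  intro g hg
  have hint := L2.integrable_inner (𝕜 := ℂ) f g
  rw [← inner_eq_zero_symm, L2.inner_def]
  refine (hasSum_setIntegral_shifts hint).unique ?_
  convert hasSum_zero with a
  have h0 : ∫ x in closedBall (a : ℚ_[p]) 1, g x ∂(haar p) = 0 := by
    rw [← inner_ballInd]; exact hg _ (h a)
  have hae : ∀ᵐ x ∂(haar p).restrict (closedBall (a : ℚ_[p]) 1),
      inner ℂ (f x) (g x) = (starRingEnd ℂ) (c a) * g x := by
    filter_upwards [ae_restrict_of_ae hf, ae_restrict_mem isClosed_closedBall.measurableSet]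
      with x hx hx'
    rw [hx, eq_of_mem_closedBall hc hx', RCLike.inner_apply, mul_comm]
  rw [integral_congr_ae hae, integral_const_mul, h0, mul_zero]

theorem invariantSubspace_le_V {φ : L2 p} (h : invariantSubspace p 1 ≤ V φ 0) (j : ℤ) :
    invariantSubspace p ((p : ℝ) ^ (-j)) ≤ V φ j := by
  rintro f ⟨c, hf, hc⟩
  -- The function `x ↦ f (p ^ j * x)` is `ℤ_p`-periodic because multiplication by `p ^ j` maps the
  -- unit ball into the ball of radius `p ^ (-j)`. Dilating back recovers `f` inside `V_j`.
  have h1 : atom f (-j) 0 ∈ V φ 0 := by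
    refine h ⟨_, atom_coeFn hf (-j) 0, fun x y hy => ?_⟩
    simp only [neg_neg, sub_zero, mul_add]
    refine hc _ _ ?_
    rw [norm_mul, Padic.norm_p_zpow]
    exact mul_le_of_le_one_right (zpow_pos_p p _).le hy
  have h2 := dilation_mem_V h1 j
  rwa [dilation_apply, atom_atom, neg_add_cancel, mul_zero, add_zero, atom_zero_zero] at h2

/-! ### The Fourier transform does not vanish on the unit ball -/

theorem truncFourier_ballInd (N : ℕ) : truncFourier (ballInd (0 : ℚ_[p]) 1) N = ballInd 0 1 := by
  refine Lp.ext ((truncFourier_coeFn _ N).trans (.trans ?_ (ballInd_coeFn 0 1).symm))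
  have h1 : cut (ballInd (0 : ℚ_[p]) 1) N =ᵐ[haar p] (closedBall 0 1).indicator 1 := by
    refine (cut_ae_eq (ballInd_coeFn 0 1) N).trans (.of_forall fun x => ?_)
    rw [Set.indicator_indicator, Set.inter_eq_right.2]
    exact closedBall_subset_closedBall (one_le_pow₀ (one_lt_p p).le)
  rw [fourierIntegral_congr_ae h1]
  refine .of_forall fun ξ => ?_
  have h2 := setIntegral_chi (p := p) 0 ξ
  simp only [neg_zero, zpow_zero, haar_real_closedBall_one, Complex.ofReal_one] at h2
  rw [show (1 : ℚ_[p] → ℂ) = fun _ => 1 from rfl, ← h2, fourierIntegral,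
    ← integral_indicator isClosed_closedBall.measurableSet]
  congr 1; ext x
  by_cases hx : x ∈ closedBall (0 : ℚ_[p]) 1 <;> simp [Set.indicator, hx, mul_comm]

theorem fourierL2_ballInd : fourierL2 (ballInd (0 : ℚ_[p]) 1) = ballInd 0 1 :=
  tendsto_nhds_unique (tendsto_truncFourier _)
    (tendsto_const_nhds.congr fun N => (truncFourier_ballInd N).symm)

theorem fourierIntegral_comp_sub (f : ℚ_[p] → ℂ) (a ξ : ℚ_[p]) :
    fourierIntegral (fun x => f (x - a)) ξ = chi (ξ * a) * fourierIntegral f ξ := by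
  rw [fourierIntegral, ← integral_add_right_eq_self _ a, fourierIntegral, ← integral_const_mul]
  congr 1; ext x
  rw [add_sub_cancel_right, mul_add, chi_add]; ring

/-- Once `‖a‖ ≤ p ^ N`, the ultrametric inequality makes the ball `B_N(0)` stable under translation
by `a`, so truncation commutes with the shift. -/
theorem truncFourier_atom (φ : L2 p) (a : ℚ_[p]) :
    ∀ᶠ N in atTop, truncFourier (atom φ 0 a) N =ᵐ[haar p]
      fun ξ => chi (ξ * a) * truncFourier φ N ξ := by
  obtain ⟨n, hn⟩ := pow_unbounded_of_one_lt ‖a‖ (one_lt_p p)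
  filter_upwards [eventually_ge_atTop n] with N hN
  have ha : ‖a‖ ≤ (p : ℝ) ^ N := hn.le.trans (pow_le_pow_right₀ (one_lt_p p).le hN)
  have h1 : cut (atom φ 0 a) N =ᵐ[haar p] fun x => cut φ N (x - a) := by
    refine (cut_ae_eq (atom_coeFn EventuallyEq.rfl 0 a) N).trans (.of_forall fun x => ?_)
    have : x ∈ closedBall (0 : ℚ_[p]) ((p : ℝ) ^ N) ↔
        x - a ∈ closedBall (0 : ℚ_[p]) ((p : ℝ) ^ N) := by
      simp only [mem_closedBall_zero_iff]
      constructor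
      · intro h
        rw [sub_eq_add_neg]
        exact (IsUltrametricDist.norm_add_le_max _ _).trans (max_le h (by rwa [norm_neg]))
      · intro h
        rw [← sub_add_cancel x a]
        exact (IsUltrametricDist.norm_add_le_max _ _).trans (max_le h ha)
    by_cases hx : x ∈ closedBall (0 : ℚ_[p]) ((p : ℝ) ^ N)
    · simp only [cut, Set.indicator_of_mem hx, Set.indicator_of_mem (this.1 hx)]; simp
    · simp only [cut, Set.indicator_of_notMem hx,
        Set.indicator_of_notMem fun h => hx (this.2 h)]
  filter_upwards [truncFourier_coeFn (atom φ 0 a) N, truncFourier_coeFn φ N] with ξ h2 h3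
  rw [h2, h3, fourierIntegral_congr_ae h1, fourierIntegral_comp_sub]

/-- Multiplication by a unimodular character is an isometry of `L²`, so the modulation formula for
the truncations survives the limit. -/
theorem fourierL2_atom (φ : L2 p) (a : ℚ_[p]) :
    fourierL2 (atom φ 0 a) =ᵐ[haar p] fun ξ => chi (ξ * a) * fourierL2 φ ξ := by
  have hm : MemLp (fun ξ => chi (ξ * a) * fourierL2 φ ξ) 2 (haar p) :=
    (Lp.memLp (fourierL2 φ)).of_le
      (((continuous_chi p).comp (by fun_prop)).aestronglyMeasurable.mul (Lp.memLp _).1)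
      (.of_forall fun x => by simp)
  have h : fourierL2 (atom φ 0 a) = hm.toLp := by
    refine tendsto_nhds_unique (tendsto_truncFourier _) ?_
    rw [tendsto_iff_norm_sub_tendsto_zero]
    refine squeeze_zero' (.of_forall fun _ => norm_nonneg _) ?_
      (tendsto_iff_norm_sub_tendsto_zero.1 (tendsto_truncFourier φ))
    filter_upwards [truncFourier_atom φ a] with N hN
    refine Lp.norm_le_norm_of_ae_le ?_
    filter_upwards [hN, hm.coeFn_toLp, Lp.coeFn_sub (truncFourier (atom φ 0 a) N) hm.toLp,
      Lp.coeFn_sub (truncFourier φ N) (fourierL2 φ)] with ξ h1 h2 h3 h4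
    rw [h3, h4, Pi.sub_apply, Pi.sub_apply, h1, h2, ← mul_sub, norm_mul, norm_chi, one_mul]
  rw [h]
  exact hm.coeFn_toLp

theorem fourierL2_ne_zero_of_ballInd_mem_V {φ : L2 p} (h : ballInd (0 : ℚ_[p]) 1 ∈ V φ 0) :
    ∀ᵐ ξ ∂(haar p), ξ ∈ closedBall (0 : ℚ_[p]) 1 → fourierL2 φ ξ ≠ 0 := by
  set s : Set ℚ_[p] := {ξ | fourierL2 φ ξ = 0} ∩ closedBall 0 1 with hs
  have hsm : MeasurableSet s :=
    ((Lp.stronglyMeasurable (fourierL2 φ)).measurable (measurableSet_singleton 0)).inter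
      isClosed_closedBall.measurableSet
  have hsf : haar p s ≠ ∞ :=
    measure_ne_top_of_subset Set.inter_subset_right (haar_closedBall_ne_top 0 1)
  -- `s` is the part of the unit ball where the transform of `φ` vanishes. Pairing with its
  -- indicator kills the transforms of all shifts of `φ`, hence by continuity those of all of `V_0`;
  -- on the self-dual indicator of `ℤ_p` the pairing gives the measure of `s`.
  set e : L2 p := indicatorConstLp 2 hsm hsf 1 with he
  have h0 : ∀ f ∈ V φ 0, inner ℂ e (fourierL2 f) = 0 := by
    have hc : IsClosed {f : L2 p | inner ℂ e (fourierL2 f) = 0} :=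
      isClosed_eq (continuous_const.inner (fourierCLM p).continuous) continuous_const
    refine fun f hf => closure_minimal (fun g hg => ?_) hc hf
    rw [Set.mem_ofPred_eq, ← fourierCLM_apply]
    induction hg using Submodule.span_induction with
    | mem x hx =>
      obtain ⟨a, rfl⟩ := hx
      rw [fourierCLM_apply, he, L2.inner_indicatorConstLp_one,
        integral_congr_ae (ae_restrict_of_ae (fourierL2_atom φ a)),
        setIntegral_congr_fun (g := fun _ => (0 : ℂ)) hsm fun ξ hξ => by
          simp only [show fourierL2 φ ξ = 0 from hξ.1, mul_zero]]
      simp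
    | zero => rw [map_zero, inner_zero_right]
    | add x y _ _ hx hy => rw [map_add, inner_add_right, hx, hy, add_zero]
    | smul k x _ hx => rw [map_smul, inner_smul_right, hx, mul_zero]
  have h1 := h0 _ h
  rw [fourierL2_ballInd, he, L2.inner_indicatorConstLp_one,
    integral_congr_ae (ae_restrict_of_ae (ballInd_coeFn 0 1)),
    setIntegral_congr_fun (g := fun _ => (1 : ℂ)) hsm fun ξ hξ => by
      simp [Set.indicator_of_mem hξ.2]] at h1
  have h2 : haar p s = 0 := by
    have : (haar p).real s = 0 := by simpa using h1
    exact (measureReal_eq_zero_iff hsf).1 this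
  rw [ae_iff]
  convert h2 using 2
  ext ξ; simp [hs, and_comm]

/-! ### Dilates of the unit ball and the final equivalence -/

theorem exists_zpow_mul_mem (ξ : ℚ_[p]) : ∃ j : ℤ, (p : ℚ_[p]) ^ j * ξ ∈ closedBall 0 1 := by
  obtain ⟨n, hn⟩ := pow_unbounded_of_one_lt ‖ξ‖ (one_lt_p p)
  refine ⟨n, ?_⟩
  rw [mem_closedBall_zero_iff, norm_mul, Padic.norm_p_zpow, zpow_neg, zpow_natCast,
    inv_mul_le_iff₀ (pow_pos (zero_lt_one.trans (one_lt_p p)) n)]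
  linarith

theorem ae_exists_dilation_ne_zero {f : ℚ_[p] → ℂ}
    (h : ∀ᵐ ξ ∂(haar p), ξ ∈ closedBall (0 : ℚ_[p]) 1 → f ξ ≠ 0) :
    ∀ᵐ ξ ∂(haar p), ∃ j : ℤ, f ((p : ℚ_[p]) ^ j * ξ) ≠ 0 := by
  filter_upwards [ae_all_iff.2 fun j : ℤ => (quasiMeasurePreserving_mul j).ae h] with ξ hξ
  obtain ⟨j, hj⟩ := exists_zpow_mul_mem ξ
  exact ⟨j, hξ j hj⟩

theorem iUnion_essSupport_dilation {f : ℚ_[p] → ℂ}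
    (h : ∀ᵐ ξ ∂(haar p), ξ ∈ closedBall (0 : ℚ_[p]) 1 → f ξ ≠ 0) :
    ⋃ j : ℤ, essSupport (fun ξ => f ((p : ℚ_[p]) ^ j * ξ)) = Set.univ := by
  refine Set.eq_univ_of_forall fun x => ?_
  obtain ⟨j, hj⟩ := exists_zpow_mul_mem x
  refine Set.mem_iUnion.2 ⟨j, fun U hU hnull => ?_⟩
  have hopen : IsOpen (closedBall (0 : ℚ_[p]) 1) :=
    IsUltrametricDist.isOpen_closedBall 0 one_ne_zero
  -- This neighbourhood of `x` has positive measure, and the dilated function is nonzero almost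
  -- everywhere on it, so the function cannot vanish almost everywhere on `U`.
  have hW : U ∩ (fun ξ => (p : ℚ_[p]) ^ j * ξ) ⁻¹' closedBall 0 1 ∈ 𝓝 x :=
    inter_mem hU ((continuous_const_mul _).continuousAt.preimage_mem_nhds (hopen.mem_nhds hj))
  refine (Measure.measure_pos_of_mem_nhds (haar p) hW).ne' ?_
  have hae := (quasiMeasurePreserving_mul (p := p) j).ae h
  refine measure_mono_null (fun ξ hξ => ?_) (measure_union_null hnull (ae_iff.1 hae))
  by_cases hf : f ((p : ℚ_[p]) ^ j * ξ) = 0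
  · exact Or.inr fun h' => h' hξ.2 hf
  · exact Or.inl ⟨hξ.1, hf⟩

end PadicMRA

theorem mainTheorem3 (p : ℕ) [Fact p.Prime] (φ : PadicMRA.L2 p)
    (hrefinable : PadicMRA.IsRefinable φ)
    (horthonormal : Orthonormal ℂ (fun a : PadicMRA.shifts p => PadicMRA.atom φ 0 (a : ℚ_[p])))
    (hsupp : PadicMRA.essSupport (PadicMRA.fourierL2 φ) ⊆ Metric.closedBall 0 1) :
    (closure (⋃ j : ℤ, (PadicMRA.V φ j : Set (PadicMRA.L2 p))) = Set.univ ↔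
      ⋃ j : ℤ, PadicMRA.essSupport (fun ξ => PadicMRA.fourierL2 φ ((p : ℚ_[p]) ^ j * ξ)) =
        Set.univ) ∧
    (closure (⋃ j : ℤ, (PadicMRA.V φ j : Set (PadicMRA.L2 p))) = Set.univ ↔
      ∀ᵐ ξ ∂(PadicMRA.haar p),
        ∃ j : ℤ, PadicMRA.fourierL2 φ ((p : ℚ_[p]) ^ j * ξ) ≠ 0) := by
  obtain ⟨c, hφ, hinv⟩ := PadicMRA.exists_invariant_representative φ hsupp
  have hball := PadicMRA.ballInd_one_mem_V hφ hinv horthonormal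
  have hdense : closure (⋃ j : ℤ, (PadicMRA.V φ j : Set (PadicMRA.L2 p))) = Set.univ := by
    refine Set.univ_subset_iff.1 ?_
    rw [← PadicMRA.closure_iUnion_invariantSubspace p]
    refine closure_mono (Set.iUnion_subset fun n => ?_)
    -- The indices `j ≥ 0` already give a dense union.
    exact Set.subset_iUnion_of_subset (n : ℤ)
      (PadicMRA.invariantSubspace_le_V (PadicMRA.invariantSubspace_one_le_V hball) n)
  have hne := PadicMRA.fourierL2_ne_zero_of_ballInd_mem_V (hball 0)
  exact ⟨iff_of_true hdense (PadicMRA.iUnion_essSupport_dilation hne),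
    iff_of_true hdense (PadicMRA.ae_exists_dilation_ne_zero hne)⟩
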